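/- Let $\mathbb V$ be a finite-dimensional vector space over a finite field $\mathbb F_q$ equipped with a non-degenerate alternating, quadratic, or Hermitian form of Witt index $D\ge 3$, and let $\Gamma$ be the dual polar graph on $\mathbb V$: its vertex set $X$ consists of the maximal totally isotropic subspaces of $\mathbb V$ (all of which have dimension $D$), and $y,z\in X$ are adjacent if and only if $\dim(y\cap z)=D-1$. Let $\partial$ be the path-length distance of $\Gamma$ and put $\Gamma_i(x)=\{y\in X:\partial(x,y)=i\}$. Fix a vertex $x\in X$ and a maximal clique $C$ of $\Gamma$ containing $x$, and let $C_i=\{y\in X:\partial(y,C)=i\}$, where $\partial(y,C)=\min_{z\in C}\partial(y,z)$. Let $\mathrm{Mat}_X(\mathbb C)$ be the algebra of complex matrices indexed by $X$, acting on the space $\mathbb C^X$ of column vectors, and for $Y\subseteq X$ let $\hat Y\in\mathbb C^X$ be its characteristic vector. Let $A_i$ $(0\le i\le D)$ be the distance matrices of $\Gamma$, where $(A_i)_{y,z}$ is $1$ if $\partial(y,z)=i$ and $0$ otherwise. The Terwilliger algebra $T(x)$ is the subalgebra of $\mathrm{Mat}_X(\mathbb C)$ generated by the $A_i$ and the diagonal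 matrices $\mathrm{diag}(\widehat{\Gamma_i(x)})$ $(0\le i\le D)$; the Terwilliger algebra $\widetilde T(C)$ is the subalgebra generated by the $A_i$ and the diagonal matrices $\mathrm{diag}(\hat C_i)$ $(0\le i\le D-1)$; and the generalized Terwilliger algebra $\mathbf T=\mathbf T(x,C)$ is the subalgebra generated by $T(x)$ and $\widetilde T(C)$. For $0\le i\le D-1$ let $C_i^-=\Gamma_i(x)\cap C_i$ and $C_i^+=\Gamma_{i+1}(x)\cap C_i$, and let $\mathbf W\subseteq\mathbb C^X$ be the linear span of the characteristic vectors $\hat C_i^{-},\hat C_i^{+}$ $(0\le i\le D-1)$. Then $\mathbf W$ is an irreducible $\mathbf T$-module; that is, $\mathbf W$ is a non-zero $\mathbf T$-invariant subspace of $\mathbb C^X$ whose only $\mathbf T$-invariant subspaces are $0$ and $\mathbf W$. -/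

import Mathlib

noncomputable section

/-! ### Non-degenerate forms, isotropic subspaces, dual polar graphs -/

/-- A non-degenerate alternating, quadratic or Hermitian form on an `F`-vector space `V`.
For a Hermitian form, `σ` is the involutory automorphism of the field (so that `|F| = r ^ 2` and
`σ a = a ^ r` when `F` is finite). -/
inductive PolarForm (F V : Type*) [Field F] [AddCommGroup V] [Module F V] where
  | alternating (B : LinearMap.BilinForm F V) (isAlt : B.IsAlt) (nondeg : B.Nondegenerate)
  | quadratic (Q : QuadraticForm F V) (nondeg : Q.Nondegenerate)
  | hermitian (σ : F →+* F) (involutive : ∀ a, σ (σ a) = a) (nontrivial : σ ≠ RingHom.id F)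
      (B : V →ₛₗ[σ] V →ₗ[F] F) (isHermitian : ∀ v w, σ (B v w) = B w v)
      (nondeg : B.Nondegenerate)

namespace PolarForm

variable {F V : Type*} [Field F] [AddCommGroup V] [Module F V]

/-- A subspace is (totally) isotropic if the form vanishes completely on it. -/
def IsIsotropic : PolarForm F V → Submodule F V → Prop
  | alternating B _ _, U => ∀ v ∈ U, ∀ w ∈ U, B v w = 0
  | quadratic Q _, U => ∀ v ∈ U, Q v = 0
  | hermitian _ _ _ B _ _, U => ∀ v ∈ U, ∀ w ∈ U, B v w = 0

/-- The Witt index: the largest dimension of an isotropic subspace (the set below is bounded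
by `dim V` when `V` is finite-dimensional, and it contains `0`). -/
def wittIndex (φ : PolarForm F V) : ℕ :=
  sSup {d | ∃ U : Submodule F V, φ.IsIsotropic U ∧ Module.finrank F U = d}

/-- The vertices of the dual polar graph: the maximal isotropic subspaces. -/
def Vertex (φ : PolarForm F V) : Type _ :=
  {U : Submodule F V // Maximal φ.IsIsotropic U}

instance (φ : PolarForm F V) : DecidableEq φ.Vertex := Classical.decEq _

instance [Finite F] [FiniteDimensional F V] (φ : PolarForm F V) : Fintype φ.Vertex :=
  haveI : Finite V := Module.finite_of_finite F
  haveI : Finite φ.Vertex :=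
    inferInstanceAs (Finite {U : Submodule F V // Maximal φ.IsIsotropic U})
  Fintype.ofFinite _

/-- The dual polar graph: maximal isotropic subspaces `x`, `y` are adjacent if and only if
`dim (x ∩ y) = D - 1`, where `D` is the Witt index. (All maximal isotropic subspaces have
dimension `D`, so the condition `x ≠ y` is redundant; it makes the graph visibly loopless.) -/
def dualPolarGraph (φ : PolarForm F V) : SimpleGraph φ.Vertex where
  Adj x y := x ≠ y ∧ Module.finrank F ↥(x.1 ⊓ y.1) + 1 = φ.wittIndex
  symm := ⟨fun _ _ h => ⟨h.1.symm, by rw [inf_comm]; exact h.2⟩⟩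
  loopless := ⟨fun _ h => h.1 rfl⟩

end PolarForm

/-! ### The generalized Terwilliger algebra and the primary module -/

namespace SimpleGraph

variable {X : Type*} (Γ : SimpleGraph X)

/-- The characteristic vector of a set of vertices. -/
def charVec (Y : Set X) : X → ℂ := Y.indicator 1

/-- `Γ_i(x)`, the vertices at path-length distance `i` from `x`. -/
def sphere (x : X) (i : ℕ) : Set X := {y | Γ.dist x y = i}

/-- The distance from a vertex `y` to a (non-empty) set `C` of vertices. -/
def distToSet (y : X) (C : Set X) : ℕ := sInf ((fun z => Γ.dist y z) '' C)

/-- `C_i`, the vertices at distance `i` from `C`. -/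
def distNeighbor (C : Set X) (i : ℕ) : Set X := {y | Γ.distToSet y C = i}

/-- `C_i⁻ = Γ_i(x) ∩ C_i`. -/
def cellMinus (x : X) (C : Set X) (i : ℕ) : Set X := Γ.sphere x i ∩ Γ.distNeighbor C i

/-- `C_i⁺ = Γ_{i+1}(x) ∩ C_i`. -/
def cellPlus (x : X) (C : Set X) (i : ℕ) : Set X := Γ.sphere x (i + 1) ∩ Γ.distNeighbor C i

/-- `𝐖`, the linear span of the characteristic vectors of `C_i⁻` and `C_i⁺`, `0 ≤ i ≤ D - 1`. -/
def primarySubspace (D : ℕ) (x : X) (C : Set X) : Submodule ℂ (X → ℂ) :=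
  Submodule.span ℂ
    {v | ∃ i < D, v = charVec (Γ.cellMinus x C i) ∨ v = charVec (Γ.cellPlus x C i)}

/-- The `i`-th distance matrix `A_i`. -/
def distMatrix (i : ℕ) : Matrix X X ℂ :=
  open Classical in Matrix.of fun y z => if Γ.dist y z = i then 1 else 0

variable [Fintype X] [DecidableEq X]

/-- The Bose-Mesner algebra `M`, generated by the distance matrices. (Indices `i` beyond the
diameter contribute only zero matrices, here and below.) -/
def boseMesner : Subalgebra ℂ (Matrix X X ℂ) :=
  Algebra.adjoin ℂ {B | ∃ i, B = Γ.distMatrix i}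

/-- The dual Bose-Mesner algebra `M^*(x)`, generated by the diagonal matrices `E_i^*(x)` whose
diagonals are the characteristic vectors of the sets `Γ_i(x)`. -/
def dualBoseMesner (x : X) : Subalgebra ℂ (Matrix X X ℂ) :=
  Algebra.adjoin ℂ {B | ∃ i, B = Matrix.diagonal (charVec (Γ.sphere x i))}

/-- The dual Bose-Mesner algebra with respect to `C`, generated by the diagonal matrices whose
diagonals are the characteristic vectors of the sets `C_i`. -/
def dualBoseMesnerSet (C : Set X) : Subalgebra ℂ (Matrix X X ℂ) :=
  Algebra.adjoin ℂ {B | ∃ i, B = Matrix.diagonal (charVec (Γ.distNeighbor C i))}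

/-- The Terwilliger algebra `T(x)` with respect to a vertex `x`. -/
def terwilliger (x : X) : Subalgebra ℂ (Matrix X X ℂ) := Γ.boseMesner ⊔ Γ.dualBoseMesner x

/-- The Terwilliger algebra with respect to a set `C` of vertices. -/
def terwilligerSet (C : Set X) : Subalgebra ℂ (Matrix X X ℂ) :=
  Γ.boseMesner ⊔ Γ.dualBoseMesnerSet C

/-- The generalized Terwilliger algebra `𝐓(x, C)`, generated by the Terwilliger algebras with
respect to `x` and with respect to `C`. -/
def generalizedTerwilliger (x : X) (C : Set X) : Subalgebra ℂ (Matrix X X ℂ) :=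
  Γ.terwilliger x ⊔ Γ.terwilligerSet C

end SimpleGraph

end

/-! The clique `C` consists of the vertices containing a hyperplane `h` of `x`. As `∂(x, y) = D -
dim (x ∩ y)` and `∂(y, C) = D - 1 - dim (h ∩ y)`, the cells `C_i^±` record the position of `y`
relative to the flag `(x, h)`. The isometries fixing this flag are transitive on every cell
(`PolarData.exists_isometry`), and each `A_i` commutes with them, so `A_i` preserves the functions
constant on cells. The diagonal generators do so trivially, and these functions form `𝐖`.

For irreducibility, take `v` in a non-zero submodule of `𝐖` with `v y ≠ 0`. The algebra contains the
projection onto the cell of `y` and the all-ones matrix, the sum of the `A_i`. Applied in turn, they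
send `v` to a non-zero constant function, whose projections to the cells span `𝐖`.

Transitivity comes from an explicit extension in the spirit of Witt. An opposite `z` of `x` can be
chosen with `y = (x ∩ y) ⊕ (z ∩ y)` (`exists_opposite`). A linear automorphism of `x` that
stabilizes `h` and moves `x ∩ y` to `x ∩ y'` extends, through dual bases of `x, z` and of `x, z'`,
to an isometry of `V` (`frameMap`), and this carries `y` to `y'`. -/

noncomputable section

open Module

/-! ### Isotropic subspaces and their dimensions -/

/-- A sesquilinear form `B` with a compatible pseudo-quadratic function `Q`: a common framework
for alternating, quadratic and Hermitian forms. -/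
structure PolarData (F V : Type*) [Field F] [AddCommGroup V] [Module F V] where
  /-- the field involution -/
  σ : F →+* F
  /-- the sign of the form -/
  κ : F
  /-- the correction in the addition formula of `Q` -/
  τ : F →+ F
  /-- the sesquilinear form -/
  B : V →ₛₗ[σ] V →ₗ[F] F
  /-- the pseudo-quadratic function -/
  Q : V → F
  σ_σ : ∀ a, σ (σ a) = a
  κ_ne_zero : κ ≠ 0
  B_swap : ∀ v w, B w v = κ * σ (B v w)
  Q_add : ∀ v w, Q (v + w) = Q v + Q w + τ (B v w)
  Q_smul : ∀ (c : F) v, Q v = 0 → Q (c • v) = 0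
  -- Demanded of singular vectors only: in characteristic 2 the polar form of a non-degenerate
  -- quadratic form may have a radical.
  exists_ne : ∀ u, u ≠ 0 → Q u = 0 → B u u = 0 → ∃ v, B u v ≠ 0
  exists_isotropic : ∀ u v, Q u = 0 → B u u = 0 → B u v ≠ 0 →
    ∃ c : F, Q (v + c • u) = 0 ∧ B (v + c • u) (v + c • u) = 0

namespace PolarData

variable {F V : Type*} [Field F] [AddCommGroup V] [Module F V] (P : PolarData F V)

/-- Totally isotropic subspaces. -/
def IsIso (U : Submodule F V) : Prop :=
  (∀ v ∈ U, P.Q v = 0) ∧ ∀ v ∈ U, ∀ w ∈ U, P.B v w = 0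

/-- The orthogonal complement of a subspace. -/
def perp (U : Submodule F V) : Submodule F V where
  carrier := {v | ∀ u ∈ U, P.B u v = 0}
  zero_mem' := by simp
  add_mem' := fun ha hb u hu => by rw [map_add, ha u hu, hb u hu, add_zero]
  smul_mem' := fun c a ha u hu => by rw [map_smul, ha u hu, smul_zero]

variable {P}

lemma B_comm_zero {v w : V} (h : P.B v w = 0) : P.B w v = 0 := by
  rw [P.B_swap, h, map_zero, mul_zero]

lemma Q_zero : P.Q 0 = 0 := by
  have := P.Q_add 0 0
  simpa using this

lemma IsIso.mono {U W : Submodule F V} (h : P.IsIso W) (hUW : U ≤ W) : P.IsIso U :=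
  ⟨fun v hv => h.1 v (hUW hv), fun v hv w hw => h.2 v (hUW hv) w (hUW hw)⟩

lemma IsIso.le_perp {U : Submodule F V} (h : P.IsIso U) : U ≤ P.perp U :=
  fun v hv u hu => h.2 u hu v hv

lemma IsIso.sup {U W : Submodule F V} (hU : P.IsIso U) (hW : P.IsIso W) (h : W ≤ P.perp U) :
    P.IsIso (U ⊔ W) := by
  constructor
  · intro v hv
    obtain ⟨a, ha, b, hb, rfl⟩ := Submodule.mem_sup.1 hv
    rw [P.Q_add, hU.1 a ha, hW.1 b hb, h hb a ha]
    simp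
  · intro v hv w hw
    obtain ⟨a, ha, b, hb, rfl⟩ := Submodule.mem_sup.1 hv
    obtain ⟨c, hc, d, hd, rfl⟩ := Submodule.mem_sup.1 hw
    have h1 := hU.2 a ha c hc
    have h2 := hW.2 b hb d hd
    have h3 : P.B a d = 0 := h hd a ha
    have h4 : P.B b c = 0 := B_comm_zero (h hb c hc)
    simp [h1, h2, h3, h4]

lemma isIso_span_singleton {v : V} (hQ : P.Q v = 0) (hB : P.B v v = 0) :
    P.IsIso (Submodule.span F {v}) := by
  constructor
  · intro w hw
    obtain ⟨c, rfl⟩ := Submodule.mem_span_singleton.1 hw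
    exact P.Q_smul c v hQ
  · intro w hw z hz
    obtain ⟨c, rfl⟩ := Submodule.mem_span_singleton.1 hw
    obtain ⟨d, rfl⟩ := Submodule.mem_span_singleton.1 hz
    simp [hB]

lemma perp_span_singleton_le {U : Submodule F V} {v : V} (hv : v ∈ P.perp U) :
    Submodule.span F {v} ≤ P.perp U := by
  rwa [Submodule.span_singleton_le_iff_mem]

lemma mem_of_mem_perp {z : Submodule F V} (hz : Maximal P.IsIso z) {v : V} (hv : v ∈ P.perp z)
    (hQ : P.Q v = 0) (hB : P.B v v = 0) : v ∈ z := by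
  have h := hz.prop.sup (isIso_span_singleton hQ hB) (perp_span_singleton_le hv)
  exact hz.le_of_ge h le_sup_left (Submodule.mem_sup_right (Submodule.mem_span_singleton_self v))

lemma IsIso.inf_perp_le {U z : Submodule F V} (hU : P.IsIso U) (hz : Maximal P.IsIso z) :
    U ⊓ P.perp z ≤ z :=
  fun v hv => mem_of_mem_perp hz hv.2 (hU.1 v hv.1) (hU.2 v hv.1 v hv.1)

/-- Pairing with finitely many vectors. -/
def pairing (P : PolarData F V) {ι : Type*} (e : ι → V) : V →ₗ[F] (ι → F) :=
  LinearMap.pi fun i => P.B (e i)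

@[simp] lemma pairing_apply {ι : Type*} (e : ι → V) (v : V) (i : ι) :
    P.pairing e v i = P.B (e i) v := rfl

lemma mem_perp_span {ι : Type*} {e : ι → V} {v : V} :
    v ∈ P.perp (Submodule.span F (Set.range e)) ↔ P.pairing e v = 0 := by
  constructor
  · intro h
    ext i
    exact h _ (Submodule.subset_span ⟨i, rfl⟩)
  · intro h u hu
    induction hu using Submodule.span_induction with
    | mem x hx =>
      obtain ⟨i, rfl⟩ := hx
      exact congrFun h i
    | zero => simp
    | add x y _ _ hx hy => simp [hx, hy]
    | smul a x _ hx => simp [hx]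

lemma B_sum_left {ι : Type*} [Fintype ι] (c : ι → F) (e : ι → V) (v : V) :
    P.B (∑ i, c i • e i) v = ∑ i, P.σ (c i) * P.B (e i) v := by
  simp [map_sum, LinearMap.sum_apply]

/-- A functional killing the range has coefficients which, twisted by `σ`, combine the `e i` into a
vector `u` with `B u = 0`. This `u` is singular, so non-degeneracy gives `u = 0`, against linear
independence. -/
lemma pairing_surjective {ι : Type*} [Fintype ι] {e : ι → V} (he : LinearIndependent F e)
    (hiso : P.IsIso (Submodule.span F (Set.range e))) : Function.Surjective (P.pairing e) := by
  classical
  rw [← LinearMap.range_eq_top]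
  by_contra hne
  obtain ⟨f, hf0, hf⟩ := Submodule.exists_le_ker_of_lt_top _ (lt_top_iff_ne_top.2 hne)
  set d : ι → F := fun i => P.σ (f (Pi.single i 1)) with hd
  set u := ∑ i, d i • e i with hu
  have hum : u ∈ Submodule.span F (Set.range e) :=
    Submodule.sum_mem _ fun i _ => Submodule.smul_mem _ _ (Submodule.subset_span ⟨i, rfl⟩)
  have hBu : ∀ v, P.B u v = 0 := by
    intro v
    have h0 : f (P.pairing e v) = 0 := hf (LinearMap.mem_range_self _ v)
    rw [LinearMap.pi_apply_eq_sum_univ f] at h0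
    rw [hu, B_sum_left, ← h0]
    refine Finset.sum_congr rfl fun i _ => ?_
    simp only [hd, P.σ_σ, pairing_apply, smul_eq_mul]
    rw [mul_comm]
    congr 2
    ext j
    simp [Pi.single_apply, eq_comm]
  have hu0 : u = 0 := by
    by_contra h
    obtain ⟨v, hv⟩ := P.exists_ne u h (hiso.1 u hum) (hiso.2 u hum u hum)
    exact hv (hBu v)
  have hd0 := Fintype.linearIndependent_iff.1 he d hu0
  apply hf0
  ext i
  have := hd0 i
  rw [hd] at this
  have h2 := congrArg P.σ this
  simpa [P.σ_σ] using h2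

lemma span_range_coe_basis {ι : Type*} {y : Submodule F V} (b : Basis ι F y) :
    Submodule.span F (Set.range fun i => (b i : V)) = y := by
  have := congrArg (Submodule.map y.subtype) b.span_eq
  rw [Submodule.map_span, Submodule.map_top, Submodule.range_subtype, ← Set.range_comp] at this
  exact this

variable [FiniteDimensional F V]

lemma exists_dual {y : Submodule F V} (hy : P.IsIso y) (f : y →ₗ[F] F) :
    ∃ v, ∀ u : y, P.B u v = P.σ (f u) := by
  let b := finBasis F y
  have hspan := span_range_coe_basis b
  have hli : LinearIndependent F (fun i => (b i : V)) :=
    b.linearIndependent.map' y.subtype (Submodule.ker_subtype y)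
  obtain ⟨v, hv⟩ := pairing_surjective (P := P) hli (by rwa [hspan]) fun i => P.σ (f (b i))
  refine ⟨v, fun u => ?_⟩
  conv_lhs => rw [← b.sum_repr u]
  conv_rhs => rw [← b.sum_repr u]
  have h : ∀ i, P.B (b i : V) v = P.σ (f (b i)) := fun i => congrFun hv i
  rw [Submodule.coe_sum]
  simp only [Submodule.coe_smul]
  rw [B_sum_left]
  simp only [h, map_sum, map_smul, smul_eq_mul, map_mul]

lemma exists_separating {y H : Submodule F V} (hy : P.IsIso y) {u : V} (hu : u ∈ y)
    (huH : u ∉ H) : ∃ v ∈ P.perp (H ⊓ y), P.B u v ≠ 0 := by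
  have h1 : (⟨u, hu⟩ : y) ∉ H.comap y.subtype := huH
  obtain ⟨f, hfu, hf⟩ := Submodule.exists_le_ker_of_notMem h1
  obtain ⟨v, hv⟩ := exists_dual hy f
  refine ⟨v, fun w hw => ?_, ?_⟩
  · have h2 : f ⟨w, hw.2⟩ = 0 := hf (show (⟨w, hw.2⟩ : y) ∈ H.comap y.subtype from hw.1)
    have := hv ⟨w, hw.2⟩
    rwa [h2, map_zero] at this
  · have := hv ⟨u, hu⟩
    rw [this]
    intro h0
    apply hfu
    have := congrArg P.σ h0
    simpa [P.σ_σ] using this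

/-- Since `z` is already orthogonal to `H ⊓ z`, only a complement of `H ⊓ z` in `H` imposes
conditions on `z`: at most `dim H - dim (H ⊓ z)` of them. -/
lemma finrank_le_inf_perp {z : Submodule F V} (hz : P.IsIso z) (H : Submodule F V) :
    finrank F z + finrank F ↥(H ⊓ z) ≤ finrank F ↥(z ⊓ P.perp H) + finrank F H := by
  obtain ⟨C', hC'⟩ := Submodule.exists_isCompl (H ⊓ z)
  set C := C' ⊓ H with hC
  have hsup : (H ⊓ z) ⊔ C = H := by
    rw [hC, ← sup_inf_assoc_of_le C' (inf_le_left : H ⊓ z ≤ H), hC'.sup_eq_top, top_inf_eq]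
  have hinf : (H ⊓ z) ⊓ C = ⊥ := by
    rw [hC, ← inf_assoc, hC'.inf_eq_bot, bot_inf_eq]
  have hdim := Submodule.finrank_sup_add_finrank_inf_eq (H ⊓ z) C
  rw [hsup, hinf, finrank_bot] at hdim
  let b := finBasis F C
  let g : z →ₗ[F] (Fin (finrank F C) → F) := (P.pairing fun i => (b i : V)) ∘ₗ z.subtype
  have hrk := g.finrank_range_add_finrank_ker
  have h1 : finrank F (LinearMap.range g) ≤ finrank F C := by
    simpa using (LinearMap.range g).finrank_le
  have hspan := span_range_coe_basis b
  have h2 : finrank F (LinearMap.ker g) ≤ finrank F ↥(z ⊓ P.perp H) := by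
    rw [← Submodule.finrank_map_subtype_eq z (LinearMap.ker g)]
    apply Submodule.finrank_mono
    rintro _ ⟨v, hv, rfl⟩
    refine ⟨v.2, fun u hu => ?_⟩
    have hvC : (v : V) ∈ P.perp C := by
      rw [← hspan, mem_perp_span]
      exact hv
    rw [← hsup] at hu
    obtain ⟨a, ha, c, hc, rfl⟩ := Submodule.mem_sup.1 hu
    rw [map_add, LinearMap.add_apply]
    have h3 := hvC c hc
    have h4 := hz.2 a ha.2 v v.2
    simp only [Submodule.subtype_apply]
    rw [h3, h4, add_zero]
  omega

/-- By maximality the part of `U` orthogonal to `z` lies in `z ⊓ U`, and the codimension of that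
part in `U` is at most `dim z - dim (z ⊓ U)`. -/
lemma IsIso.finrank_le {U z : Submodule F V} (hU : P.IsIso U) (hz : Maximal P.IsIso z) :
    finrank F U ≤ finrank F z := by
  have h1 := finrank_le_inf_perp hU z
  have h2 : finrank F ↥(U ⊓ P.perp z) ≤ finrank F ↥(z ⊓ U) :=
    Submodule.finrank_mono (le_inf (hU.inf_perp_le hz) inf_le_left)
  omega

lemma finrank_eq_of_maximal {y z : Submodule F V} (hy : Maximal P.IsIso y)
    (hz : Maximal P.IsIso z) : finrank F y = finrank F z :=
  le_antisymm (hy.prop.finrank_le hz) (hz.prop.finrank_le hy)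

lemma IsIso.maximal {U z : Submodule F V} (hU : P.IsIso U) (hz : Maximal P.IsIso z)
    (h : finrank F z ≤ finrank F U) : Maximal P.IsIso U := by
  refine ⟨hU, fun W hW hUW => ?_⟩
  rw [Submodule.eq_of_le_of_finrank_le hUW ((hW.finrank_le hz).trans h)]

/-- The projection of a maximal isotropic subspace `z` to the residue of an isotropic `H`. -/
lemma maximal_sup_inf_perp {H z : Submodule F V} (hH : P.IsIso H) (hz : Maximal P.IsIso z) :
    Maximal P.IsIso (H ⊔ (z ⊓ P.perp H)) := by
  refine IsIso.maximal (hH.sup (hz.prop.mono inf_le_left) inf_le_right) hz ?_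
  have h1 := Submodule.finrank_sup_add_finrank_inf_eq H (z ⊓ P.perp H)
  have h2 := finrank_le_inf_perp hz.prop H
  have h3 : finrank F ↥(H ⊓ (z ⊓ P.perp H)) ≤ finrank F ↥(H ⊓ z) :=
    Submodule.finrank_mono (inf_le_inf_left _ inf_le_left)
  omega

/-- Every hyperplane of a maximal isotropic subspace lies in a second one. -/
lemma exists_maximal_inf_eq {y H : Submodule F V} (hy : Maximal P.IsIso y) (hHy : H ≤ y)
    (hd : finrank F H + 1 = finrank F y) : ∃ w, Maximal P.IsIso w ∧ w ⊓ y = H := by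
  have hlt : H < y := lt_of_le_of_ne hHy (by rintro rfl; omega)
  obtain ⟨u, hu, huH⟩ := SetLike.exists_of_lt hlt
  obtain ⟨v, hv, huv⟩ := exists_separating hy.prop hu huH
  rw [inf_eq_left.2 hHy] at hv
  have hQu := hy.prop.1 u hu
  have hBu := hy.prop.2 u hu u hu
  -- Moving `v` along `u` makes it isotropic and keeps it orthogonal to `H` but not to `u`; the
  -- second subspace is `H + ⟨v'⟩`.
  obtain ⟨c, hQ, hB⟩ := P.exists_isotropic u v hQu hBu huv
  set v' := v + c • u with hv'
  have hvp : v' ∈ P.perp H := by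
    intro w hw
    rw [hv', map_add, map_smul, hv w hw, hy.prop.2 w (hHy hw) u hu, smul_zero, add_zero]
  have huv' : P.B u v' ≠ 0 := by
    rw [hv', map_add, map_smul, hBu, smul_zero, add_zero]
    exact huv
  have hvy : v' ∉ y := fun h => huv' (hy.prop.2 u hu v' h)
  have hiso := (hy.prop.mono hHy).sup (isIso_span_singleton hQ hB) (perp_span_singleton_le hvp)
  have hHw : H < H ⊔ Submodule.span F {v'} :=
    lt_of_le_of_ne le_sup_left fun h => hvy (hHy (by
      rw [h]; exact Submodule.mem_sup_right (Submodule.mem_span_singleton_self v')))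
  have hmax := hiso.maximal hy (by have := Submodule.finrank_lt_finrank_of_lt hHw; omega)
  refine ⟨_, hmax, ?_⟩
  have hle : H ≤ (H ⊔ Submodule.span F {v'}) ⊓ y := le_inf le_sup_left hHy
  symm
  apply Submodule.eq_of_le_of_finrank_le hle
  have hlt2 : (H ⊔ Submodule.span F {v'}) ⊓ y < y := by
    refine lt_of_le_of_ne inf_le_right fun h => ?_
    have := hy.eq_of_le hmax.prop (inf_eq_right.1 h)
    apply hvy
    rw [this]
    exact Submodule.mem_sup_right (Submodule.mem_span_singleton_self v')
  have := Submodule.finrank_lt_finrank_of_lt hlt2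
  omega

lemma exists_hyperplane_notMem {A y : Submodule F V} (hA : A ≤ y) {u : V} (hu : u ∈ y)
    (huA : u ∉ A) : ∃ H, A ≤ H ∧ H ≤ y ∧ u ∉ H ∧ finrank F H + 1 = finrank F y := by
  obtain ⟨f, hfu, hf⟩ := Submodule.exists_le_ker_of_notMem huA
  refine ⟨LinearMap.ker f ⊓ y, le_inf hf hA, inf_le_right, fun h => hfu h.1, ?_⟩
  have h1 := LinearMap.finrank_range_add_finrank_ker (f ∘ₗ y.subtype)
  have h2 : LinearMap.range (f ∘ₗ y.subtype) = ⊤ := by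
    rw [LinearMap.range_eq_top]
    apply LinearMap.surjective
    intro h
    exact hfu (LinearMap.congr_fun h ⟨u, hu⟩)
  rw [h2, finrank_top, finrank_self, LinearMap.ker_comp,
    ← Submodule.finrank_map_subtype_eq, Submodule.map_comap_subtype, inf_comm] at h1
  omega

end PolarData
end

/-! ### Linear automorphisms stabilizing a hyperplane -/

noncomputable section

open Module

section LinearAlgebra

variable {F W : Type*} [Field F] [AddCommGroup W] [Module F W] [FiniteDimensional F W]

lemma Submodule.exists_linearEquiv_map_eq {T T' : Submodule F W}
    (h : finrank F T = finrank F T') : ∃ m : W ≃ₗ[F] W, T.map (m : W →ₗ[F] W) = T' := by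
  obtain ⟨m, hm⟩ := Submodule.exists_linearEquiv_restrict_eq (LinearEquiv.ofFinrankEq T T' h)
  refine ⟨m, Submodule.eq_of_le_of_finrank_le ?_ ?_⟩
  · rintro _ ⟨v, hv, rfl⟩
    have := hm ⟨v, hv⟩
    simp only [LinearEquiv.coe_coe]
    rw [← this]
    exact Subtype.coe_prop _
  · rw [LinearEquiv.finrank_map_eq, h]

/-- Automorphisms stabilizing a hyperplane `ker φ` move a pair `(T, s)`, where `T ≤ ker φ` and
`s ∉ ker φ`, to any other such pair. -/
lemma exists_linearEquiv_map_ker_eq (φ : W →ₗ[F] F) {T T' : Submodule F W}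
    (hT : T ≤ LinearMap.ker φ) (hT' : T' ≤ LinearMap.ker φ) (h : finrank F T = finrank F T')
    {s s' : W} (hs : φ s ≠ 0) (hs' : φ s' ≠ 0) :
    ∃ m : W ≃ₗ[F] W, T.map (m : W →ₗ[F] W) = T' ∧
      (LinearMap.ker φ).map (m : W →ₗ[F] W) = LinearMap.ker φ ∧ m s = s' := by
  set K := LinearMap.ker φ with hK
  have hfr : finrank F (T.comap K.subtype) = finrank F (T'.comap K.subtype) := by
    rw [← Submodule.finrank_map_subtype_eq K, ← Submodule.finrank_map_subtype_eq K,
      Submodule.map_comap_subtype, Submodule.map_comap_subtype, inf_eq_right.2 hT,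
      inf_eq_right.2 hT', h]
  obtain ⟨n, hn⟩ := Submodule.exists_linearEquiv_map_eq hfr
  obtain ⟨m, hm⟩ := Submodule.exists_linearEquiv_restrict_eq n
  have hmK : ∀ v, v ∈ K → m v ∈ K := fun v hv => by
    rw [← hm ⟨v, hv⟩]; exact Subtype.coe_prop _
  have hmKeq : K.map (m : W →ₗ[F] W) = K := by
    refine Submodule.eq_of_le_of_finrank_le ?_ (by rw [LinearEquiv.finrank_map_eq])
    rintro _ ⟨v, hv, rfl⟩
    exact hmK v hv
  have hms : φ (m s) ≠ 0 := by
    intro h0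
    have : m s ∈ K.map (m : W →ₗ[F] W) := by rw [hmKeq]; exact h0
    obtain ⟨v, hv, hvs⟩ := this
    have := m.injective hvs
    subst this
    exact hs hv
  -- Fixes `K` pointwise and sends `m s` to `s'`, correcting an arbitrary extension `m` outside the
  -- hyperplane.
  let p : W →ₗ[F] W := LinearMap.id + (φ.smulRight ((φ (m s))⁻¹ • (s' - m s)))
  have hp : ∀ v, p v = v + φ v • (φ (m s))⁻¹ • (s' - m s) := fun v => rfl
  have hpφ : ∀ v, φ (p v) = φ v * (φ (m s))⁻¹ * φ s' := by
    intro v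
    rw [hp]
    simp only [map_add, map_smul, map_sub, smul_eq_mul]
    field_simp
    ring
  have hpK : ∀ v, v ∈ K → p v = v := by
    intro v hv
    have : φ v = 0 := hv
    rw [hp, this, zero_smul, add_zero]
  have hpinj : Function.Injective p := by
    rw [← LinearMap.ker_eq_bot, LinearMap.ker_eq_bot']
    intro v hv
    have h1 := hpφ v
    rw [hv, map_zero] at h1
    have h2 : φ v = 0 := by
      by_contra h3
      exact (mul_ne_zero (mul_ne_zero h3 (inv_ne_zero hms)) hs') h1.symm
    rwa [hpK v h2] at hv
  refine ⟨m.trans (LinearEquiv.ofInjectiveEndo p hpinj), ?_, ?_, ?_⟩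
  · refine Submodule.eq_of_le_of_finrank_le ?_ (by rw [LinearEquiv.finrank_map_eq, h])
    rintro _ ⟨v, hv, rfl⟩
    have h1 : m v ∈ T' := by
      have h2 : n ⟨v, hT hv⟩ ∈ T'.comap K.subtype := by
        rw [← hn]
        exact ⟨⟨v, hT hv⟩, hv, rfl⟩
      rw [← hm ⟨v, hT hv⟩]
      exact h2
    have h3 := hpK _ (hmK v (hT hv))
    simpa [h3] using h1
  · refine Submodule.eq_of_le_of_finrank_le ?_ (by rw [LinearEquiv.finrank_map_eq])
    rintro _ ⟨v, hv, rfl⟩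
    have h3 := hpK _ (hmK v hv)
    simpa [h3] using hmK v hv
  · have h4 : p (m s) = s' := by
      rw [hp, smul_smul, mul_inv_cancel₀ hms, one_smul]
      abel
    simpa using h4

/-- The stabilizer of a hyperplane `h` is transitive on the subspaces of a given dimension lying
in `h`, and on those not lying in `h`. -/
lemma exists_linearEquiv_map_hyperplane_eq {h S S' : Submodule F W}
    (hh : finrank F h + 1 = finrank F W) (hS : finrank F S = finrank F S')
    (hle : S ≤ h ↔ S' ≤ h) :
    ∃ m : W ≃ₗ[F] W, S.map (m : W →ₗ[F] W) = S' ∧ h.map (m : W →ₗ[F] W) = h := by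
  have hlt : h < ⊤ := by
    rw [lt_top_iff_ne_top]
    rintro rfl
    rw [finrank_top] at hh
    omega
  obtain ⟨φ, hφ0, hφ⟩ := Submodule.exists_le_ker_of_lt_top h hlt
  have hker : h = LinearMap.ker φ := by
    apply Submodule.eq_of_le_of_finrank_le hφ
    have h1 := φ.finrank_range_add_finrank_ker
    rw [LinearMap.range_eq_top.2 (LinearMap.surjective hφ0), finrank_top, finrank_self] at h1
    omega
  by_cases hc : S ≤ h
  · have hc' := hle.1 hc
    rw [hker] at hc hc' ⊢
    obtain ⟨s, hs⟩ : ∃ s, φ s ≠ 0 := by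
      by_contra! h0
      exact hφ0 (LinearMap.ext h0)
    obtain ⟨m, h1, h2, -⟩ := exists_linearEquiv_map_ker_eq φ hc hc' hS hs hs
    exact ⟨m, h1, h2⟩
  · have hc' := fun h0 => hc (hle.2 h0)
    have hdim : ∀ A : Submodule F W, ¬ A ≤ h →
        finrank F ↥(A ⊓ h) + 1 = finrank F A ∧ ∃ s ∈ A, φ s ≠ 0 := by
      intro A hA
      obtain ⟨s, hsA, hsh⟩ := SetLike.not_le_iff_exists.1 hA
      refine ⟨?_, s, hsA, by rw [hker] at hsh; exact hsh⟩
      have h1 := Submodule.finrank_sup_add_finrank_inf_eq A h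
      have h2 : h < A ⊔ h := lt_of_le_of_ne le_sup_right fun h0 => hA (by
        rw [h0]; exact le_sup_left)
      have h3 := Submodule.finrank_lt_finrank_of_lt h2
      have h4 := (A ⊔ h).finrank_le
      omega
    obtain ⟨hd, s, hsS, hs⟩ := hdim S hc
    obtain ⟨hd', s', hsS', hs'⟩ := hdim S' hc'
    obtain ⟨m, h1, h2, h3⟩ := exists_linearEquiv_map_ker_eq φ (T := S ⊓ h) (T' := S' ⊓ h)
      (inf_le_right.trans hφ) (inf_le_right.trans hφ) (by omega) hs hs'
    refine ⟨m, Submodule.eq_of_le_of_finrank_le ?_ (by rw [LinearEquiv.finrank_map_eq, hS]),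
      by rw [hker]; exact h2⟩
    have hsplit : S = (S ⊓ h) ⊔ Submodule.span F {s} := by
      symm
      have hlt : S ⊓ h < (S ⊓ h) ⊔ Submodule.span F {s} := by
        refine lt_of_le_of_ne le_sup_left fun h0 => hs ?_
        have : s ∈ S ⊓ h := by
          rw [h0]
          exact Submodule.mem_sup_right (Submodule.mem_span_singleton_self s)
        exact hφ this.2
      refine Submodule.eq_of_le_of_finrank_le (sup_le inf_le_left ?_) ?_
      · rwa [Submodule.span_singleton_le_iff_mem]
      · have := Submodule.finrank_lt_finrank_of_lt hlt
        omega
    rw [hsplit, Submodule.map_sup, h1, Submodule.map_span, Set.image_singleton]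
    refine sup_le inf_le_left ?_
    rw [Submodule.span_singleton_le_iff_mem]
    simpa [h3] using hsS'

end LinearAlgebra

/-! ### Frames, opposites and transitivity of isometries -/

namespace PolarData

variable {F V : Type*} [Field F] [AddCommGroup V] [Module F V] {P : PolarData F V}

/-- Dual bases of two opposite isotropic subspaces. -/
structure IsFrame (P : PolarData F V) {ι : Type*} [DecidableEq ι] (e f : ι → V) : Prop where
  pair : ∀ i j, P.B (e i) (f j) = if i = j then 1 else 0
  iso_left : P.IsIso (Submodule.span F (Set.range e))
  iso_right : P.IsIso (Submodule.span F (Set.range f))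

lemma IsFrame.pair_swap {ι : Type*} [DecidableEq ι] {e f : ι → V} (hf : P.IsFrame e f)
    (i j : ι) : P.B (f i) (e j) = if i = j then P.κ else 0 := by
  rw [P.B_swap, hf.pair]
  by_cases h : i = j
  · simp [h]
  · simp [h, Ne.symm h]

section Frame

variable {ι : Type*} [Fintype ι]

lemma lc_mem (e : ι → V) (a : ι → F) :
    Fintype.linearCombination F e a ∈ Submodule.span F (Set.range e) := by
  rw [← Fintype.range_linearCombination]
  exact LinearMap.mem_range_self _ _

/-- The projection to the orthogonal complement of a frame. -/
def frameProj (P : PolarData F V) (e f : ι → V) : V →ₗ[F] V :=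
  LinearMap.id - Fintype.linearCombination F f ∘ₗ P.pairing e
    - P.κ⁻¹ • (Fintype.linearCombination F e ∘ₗ P.pairing f)

lemma frameProj_apply (e f : ι → V) (v : V) : P.frameProj e f v =
    v - Fintype.linearCombination F f (P.pairing e v)
      - Fintype.linearCombination F e (P.κ⁻¹ • P.pairing f v) := by
  simp [frameProj]

lemma frame_decomp (e f : ι → V) (v : V) :
    v = Fintype.linearCombination F f (P.pairing e v)
      + Fintype.linearCombination F e (P.κ⁻¹ • P.pairing f v) + P.frameProj e f v := by
  rw [frameProj_apply]
  abel

/-- The map carrying the frame `(e, f)` to the frame `(e', f')`. -/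
def frameMap (P : PolarData F V) (e f e' f' : ι → V) : V →ₗ[F] V :=
  Fintype.linearCombination F f' ∘ₗ P.pairing e
    + P.κ⁻¹ • (Fintype.linearCombination F e' ∘ₗ P.pairing f)
    + P.frameProj e' f' ∘ₗ P.frameProj e f

lemma frameMap_apply (e f e' f' : ι → V) (v : V) : P.frameMap e f e' f' v =
    Fintype.linearCombination F f' (P.pairing e v)
      + Fintype.linearCombination F e' (P.κ⁻¹ • P.pairing f v)
      + P.frameProj e' f' (P.frameProj e f v) := by
  simp [frameMap]

variable [DecidableEq ι]

namespace IsFrame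

variable {e f : ι → V} (hf : P.IsFrame e f)

include hf

lemma pairing_left_left (a : ι → F) : P.pairing e (Fintype.linearCombination F e a) = 0 := by
  rw [← mem_perp_span]
  exact hf.iso_left.le_perp (lc_mem e a)

lemma pairing_right_right (a : ι → F) : P.pairing f (Fintype.linearCombination F f a) = 0 := by
  rw [← mem_perp_span]
  exact hf.iso_right.le_perp (lc_mem f a)

lemma pairing_left_right (a : ι → F) : P.pairing e (Fintype.linearCombination F f a) = a := by
  ext i
  simp [Fintype.linearCombination_apply, hf.pair]

lemma pairing_right_left (a : ι → F) :
    P.pairing f (Fintype.linearCombination F e a) = P.κ • a := by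
  ext i
  simp [Fintype.linearCombination_apply, hf.pair_swap, mul_comm]

lemma frameProj_left (a : ι → F) : P.frameProj e f (Fintype.linearCombination F e a) = 0 := by
  rw [frameProj_apply, hf.pairing_left_left, hf.pairing_right_left, smul_smul,
    inv_mul_cancel₀ P.κ_ne_zero]
  simp

lemma frameProj_right (a : ι → F) : P.frameProj e f (Fintype.linearCombination F f a) = 0 := by
  rw [frameProj_apply, hf.pairing_left_right, hf.pairing_right_right]
  simp

lemma pairing_left_frameProj (v : V) : P.pairing e (P.frameProj e f v) = 0 := by
  rw [frameProj_apply, map_sub, map_sub, hf.pairing_left_right, hf.pairing_left_left]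
  simp

lemma pairing_right_frameProj (v : V) : P.pairing f (P.frameProj e f v) = 0 := by
  rw [frameProj_apply, map_sub, map_sub, hf.pairing_right_right, hf.pairing_right_left, smul_smul,
    mul_inv_cancel₀ P.κ_ne_zero]
  simp

lemma B_left_right (a b : ι → F) :
    P.B (Fintype.linearCombination F e a) (Fintype.linearCombination F f b)
      = ∑ i, P.σ (a i) * b i := by
  rw [Fintype.linearCombination_apply F e, B_sum_left]
  refine Finset.sum_congr rfl fun i _ => ?_
  rw [← pairing_apply e, hf.pairing_left_right]

lemma B_frame {r s : V} (hre : P.pairing e r = 0) (hrf : P.pairing f r = 0)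
    (hse : P.pairing e s = 0) (hsf : P.pairing f s = 0) (a b a' b' : ι → F) :
    P.B (Fintype.linearCombination F f b + Fintype.linearCombination F e a + r)
      (Fintype.linearCombination F f b' + Fintype.linearCombination F e a' + s)
      = P.κ * P.σ (∑ i, P.σ (a' i) * b i) + ∑ i, P.σ (a i) * b' i + P.B r s := by
  rw [← mem_perp_span] at hre hrf hse hsf
  have h1 := hf.iso_left.2 _ (lc_mem e a) _ (lc_mem e a')
  have h2 := hf.iso_right.2 _ (lc_mem f b) _ (lc_mem f b')
  have h3 := hse _ (lc_mem e a)
  have h4 := hsf _ (lc_mem f b)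
  have h5 := B_comm_zero (hre _ (lc_mem e a'))
  have h6 := B_comm_zero (hrf _ (lc_mem f b'))
  have h7 := hf.B_left_right a b'
  have h8 := P.B_swap (Fintype.linearCombination F e a') (Fintype.linearCombination F f b)
  rw [hf.B_left_right a' b] at h8
  simp only [map_add, LinearMap.add_apply, h1, h2, h3, h4, h5, h6, h7, h8]
  ring

lemma Q_frame {r : V} (hre : P.pairing e r = 0) (hrf : P.pairing f r = 0) (a b : ι → F) :
    P.Q (Fintype.linearCombination F f b + Fintype.linearCombination F e a + r)
      = P.τ (P.κ * P.σ (∑ i, P.σ (a i) * b i)) + P.Q r := by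
  rw [← mem_perp_span] at hre hrf
  have h1 := hf.iso_left.1 _ (lc_mem e a)
  have h2 := hf.iso_right.1 _ (lc_mem f b)
  have h3 := hre _ (lc_mem e a)
  have h4 := hrf _ (lc_mem f b)
  have h8 := P.B_swap (Fintype.linearCombination F e a) (Fintype.linearCombination F f b)
  rw [hf.B_left_right a b] at h8
  rw [P.Q_add, P.Q_add, map_add, LinearMap.add_apply, h1, h2, h3, h4, h8]
  simp

end IsFrame

section FrameMap

variable {e f e' f' : ι → V} (hf : P.IsFrame e f) (hf' : P.IsFrame e' f')

include hf

lemma frameMap_left (a : ι → F) : P.frameMap e f e' f' (Fintype.linearCombination F e a) =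
    Fintype.linearCombination F e' a := by
  rw [frameMap_apply, hf.pairing_left_left, hf.pairing_right_left, hf.frameProj_left, smul_smul,
    inv_mul_cancel₀ P.κ_ne_zero]
  simp

lemma frameMap_right (a : ι → F) : P.frameMap e f e' f' (Fintype.linearCombination F f a) =
    Fintype.linearCombination F f' a := by
  rw [frameMap_apply, hf.pairing_left_right, hf.pairing_right_right, hf.frameProj_right]
  simp

variable (hspan : Submodule.span F (Set.range e) = Submodule.span F (Set.range e'))

include hspan

/-- The complement of the frame `(e, f)` is orthogonal to the common span of `e` and `e'`, so the
second projection only subtracts an element of that span. Such an element is singular and orthogonal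
to the complement, hence invisible to `B` and `Q`; this is why `frameMap` is an isometry. -/
lemma frameProj_frameProj (v : V) : ∃ u ∈ Submodule.span F (Set.range e),
    P.frameProj e' f' (P.frameProj e f v) = P.frameProj e f v + u := by
  refine ⟨- Fintype.linearCombination F e' (P.κ⁻¹ • P.pairing f' (P.frameProj e f v)), ?_, ?_⟩
  · rw [hspan]
    exact Submodule.neg_mem _ (lc_mem _ _)
  · have h : P.pairing e' (P.frameProj e f v) = 0 := by
      rw [← mem_perp_span, ← hspan, mem_perp_span]
      exact hf.pairing_left_frameProj v
    rw [frameProj_apply e' f', h]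
    simp [sub_eq_add_neg]

lemma B_frameProj (v w : V) :
    P.B (P.frameProj e' f' (P.frameProj e f v)) (P.frameProj e' f' (P.frameProj e f w)) =
      P.B (P.frameProj e f v) (P.frameProj e f w) := by
  obtain ⟨u, hu, hv⟩ := frameProj_frameProj (f' := f') hf hspan v
  obtain ⟨u', hu', hw⟩ := frameProj_frameProj (f' := f') hf hspan w
  have h1 := mem_perp_span.2 (hf.pairing_left_frameProj v) u' hu'
  have h2 := mem_perp_span.2 (hf.pairing_left_frameProj w) u hu
  rw [hv, hw]
  simp only [map_add, LinearMap.add_apply, B_comm_zero h1, h2, hf.iso_left.2 u hu u' hu', add_zero]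

lemma Q_frameProj (v : V) : P.Q (P.frameProj e' f' (P.frameProj e f v)) =
    P.Q (P.frameProj e f v) := by
  obtain ⟨u, hu, hv⟩ := frameProj_frameProj (f' := f') hf hspan v
  have h1 := mem_perp_span.2 (hf.pairing_left_frameProj v) u hu
  rw [hv, P.Q_add, B_comm_zero h1, hf.iso_left.1 u hu]
  simp

include hf'

lemma B_frameMap (v w : V) :
    P.B (P.frameMap e f e' f' v) (P.frameMap e f e' f' w) = P.B v w := by
  conv_rhs => rw [frame_decomp (P := P) e f v, frame_decomp (P := P) e f w]
  rw [frameMap_apply, frameMap_apply,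
    hf'.B_frame (hf'.pairing_left_frameProj _) (hf'.pairing_right_frameProj _)
      (hf'.pairing_left_frameProj _) (hf'.pairing_right_frameProj _),
    hf.B_frame (hf.pairing_left_frameProj _) (hf.pairing_right_frameProj _)
      (hf.pairing_left_frameProj _) (hf.pairing_right_frameProj _), B_frameProj hf hspan]

lemma Q_frameMap (v : V) : P.Q (P.frameMap e f e' f' v) = P.Q v := by
  conv_rhs => rw [frame_decomp (P := P) e f v]
  rw [frameMap_apply,
    hf'.Q_frame (hf'.pairing_left_frameProj _) (hf'.pairing_right_frameProj _),
    hf.Q_frame (hf.pairing_left_frameProj _) (hf.pairing_right_frameProj _),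
    Q_frameProj hf hspan]

end FrameMap

end Frame

lemma injective_of_isometry {g : V →ₗ[F] V} (hB : ∀ v w, P.B (g v) (g w) = P.B v w)
    (hQ : ∀ v, P.Q (g v) = P.Q v) : Function.Injective g := by
  rw [← LinearMap.ker_eq_bot, LinearMap.ker_eq_bot']
  intro v hv
  by_contra h
  have h1 : P.Q v = 0 := by rw [← hQ, hv, Q_zero]
  have h2 : ∀ w, P.B v w = 0 := fun w => by rw [← hB, hv]; simp
  obtain ⟨w, hw⟩ := P.exists_ne v h h1 (h2 v)
  exact hw (h2 w)

variable [FiniteDimensional F V]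

/-- Any two maximal isotropic subspaces `x`, `y` lie on a geodesic that ends in an opposite
of `x`. -/
lemma exists_opposite {x y : Submodule F V} (hx : Maximal P.IsIso x) (hy : Maximal P.IsIso y) :
    ∃ z, Maximal P.IsIso z ∧ z ⊓ x = ⊥ ∧
      finrank F x ≤ finrank F ↥(z ⊓ y) + finrank F ↥(x ⊓ y) := by
  induction hn : finrank F ↥(x ⊓ y) using Nat.strong_induction_on generalizing y with
  | _ n ih =>
  by_cases h0 : x ⊓ y = ⊥
  · refine ⟨y, hy, by rw [inf_comm, h0], ?_⟩
    rw [inf_idem, finrank_eq_of_maximal hx hy]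
    omega
  obtain ⟨u, hu, hu0⟩ := Submodule.exists_mem_ne_zero_of_ne_bot h0
  obtain ⟨H, -, hHy, huH, hH⟩ := exists_hyperplane_notMem (F := F) (bot_le : ⊥ ≤ y) hu.2
    (by simpa using hu0)
  obtain ⟨w, hw, hwy⟩ := exists_maximal_inf_eq hy hHy hH
  have hyH : H ⊔ Submodule.span F {u} = y := by
    have hlt : H < H ⊔ Submodule.span F {u} := lt_of_le_of_ne le_sup_left fun h => huH (by
      rw [h]; exact Submodule.mem_sup_right (Submodule.mem_span_singleton_self u))
    refine Submodule.eq_of_le_of_finrank_le (sup_le hHy ?_) ?_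
    · rw [Submodule.span_singleton_le_iff_mem]
      exact hu.2
    · have := Submodule.finrank_lt_finrank_of_lt hlt
      omega
  have hHw : H ≤ w := hwy ▸ inf_le_left
  -- A vector of `x ⊓ w` is orthogonal to `H ≤ w` and to `u ∈ x`, hence to `y`. So passing from `y`
  -- to `w` shrinks the intersection with `x`, which drives the induction.
  have hxw : x ⊓ w ≤ y := by
    intro v hv
    refine mem_of_mem_perp hy (fun t ht => ?_) (hx.prop.1 v hv.1) (hx.prop.2 v hv.1 v hv.1)
    rw [← hyH] at ht
    obtain ⟨a, ha, b, hb, rfl⟩ := Submodule.mem_sup.1 ht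
    obtain ⟨c, rfl⟩ := Submodule.mem_span_singleton.1 hb
    have h1 := hw.prop.2 a (hHw ha) v hv.2
    have h2 := hx.prop.2 u hu.1 v hv.1
    simp [h1, h2]
  have hlt : x ⊓ w < x ⊓ y := by
    refine lt_of_le_of_ne (le_inf inf_le_left hxw) fun h => huH ?_
    rw [← h] at hu
    rw [← hwy]
    exact ⟨hu.2, hxw hu⟩
  have hlt' := Submodule.finrank_lt_finrank_of_lt hlt
  obtain ⟨z, hz, hzx, hzw⟩ := ih _ (by omega) hw rfl
  refine ⟨z, hz, hzx, ?_⟩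
  -- Intersecting `z ⊓ w` with the hyperplane `H` of `w` costs at most one dimension, offset by the
  -- strict growth from `x ⊓ w` to `x ⊓ y`.
  have h1 := Submodule.finrank_sup_add_finrank_inf_eq (z ⊓ w) H
  have h2 : finrank F ↥(z ⊓ w ⊔ H) ≤ finrank F w :=
    Submodule.finrank_mono (sup_le inf_le_right hHw)
  have h3 : finrank F ↥(z ⊓ w ⊓ H) ≤ finrank F ↥(z ⊓ y) :=
    Submodule.finrank_mono (inf_le_inf inf_le_left hHy)
  have h4 := finrank_eq_of_maximal hw hy
  omega

/-- A vector of `z` orthogonal to `x` lies in `z ⊓ x = ⊥`, so pairing with `b` is injective on `z`,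
hence bijective by dimension; `f` is the preimage of the standard basis. -/
lemma exists_frame {x z : Submodule F V} (hx : Maximal P.IsIso x) (hz : Maximal P.IsIso z)
    (hzx : z ⊓ x = ⊥) {n : ℕ} (b : Basis (Fin n) F x) :
    ∃ f : Fin n → V, P.IsFrame (fun i => (b i : V)) f ∧ Submodule.span F (Set.range f) = z := by
  let L : z →ₗ[F] (Fin n → F) := P.pairing (fun i => (b i : V)) ∘ₗ z.subtype
  have hinj : Function.Injective L := by
    rw [← LinearMap.ker_eq_bot, LinearMap.ker_eq_bot']
    intro v hv
    have h1 : (v : V) ∈ P.perp x := by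
      rw [← span_range_coe_basis b, mem_perp_span]
      exact hv
    have h2 : (v : V) ∈ z ⊓ x := ⟨v.2, hz.prop.inf_perp_le hx ⟨v.2, h1⟩⟩
    rw [hzx] at h2
    simpa using h2
  have hfr : finrank F z = finrank F (Fin n → F) := by
    rw [finrank_eq_of_maximal hz hx, finrank_eq_card_basis b]
    simp
  let L' := LinearEquiv.ofInjectiveOfFinrankEq L hinj hfr
  let c := (Pi.basisFun F (Fin n)).map L'.symm
  have hspan := span_range_coe_basis c
  refine ⟨fun i => c i, ⟨fun i j => ?_, ?_, ?_⟩, hspan⟩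
  · have h1 : L (c j) = Pi.single j 1 := by
      have : L' (c j) = Pi.single j 1 := by simp [c]
      exact this
    have := congrFun h1 i
    rw [Pi.single_apply] at this
    exact this
  · rw [span_range_coe_basis]
    exact hx.prop
  · rw [hspan]
    exact hz.prop

/-- The stabilizer of a maximal isotropic subspace `x` and a hyperplane `h` of `x` in the isometry
group is transitive on the maximal isotropic subspaces in a given position to `x` and `h`. -/
theorem exists_isometry {x h y y' : Submodule F V} (hx : Maximal P.IsIso x) (hhx : h ≤ x)
    (hh : finrank F h + 1 = finrank F x) (hy : Maximal P.IsIso y) (hy' : Maximal P.IsIso y')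
    (hd : finrank F ↥(x ⊓ y) = finrank F ↥(x ⊓ y')) (hle : x ⊓ y ≤ h ↔ x ⊓ y' ≤ h) :
    ∃ g : V ≃ₗ[F] V, (∀ v w, P.B (g v) (g w) = P.B v w) ∧ (∀ v, P.Q (g v) = P.Q v) ∧
      x.map (g : V →ₗ[F] V) = x ∧ h.map (g : V →ₗ[F] V) = h ∧ y.map (g : V →ₗ[F] V) = y' := by
  obtain ⟨z, hz, hzx, hzy⟩ := exists_opposite hx hy
  obtain ⟨z', hz', hzx', hzy'⟩ := exists_opposite hx hy'
  have hfr : ∀ A : Submodule F V, A ≤ x → finrank F (A.comap x.subtype) = finrank F A := by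
    intro A hA
    rw [← Submodule.finrank_map_subtype_eq, Submodule.map_comap_subtype, inf_eq_right.2 hA]
  have hcm : ∀ A : Submodule F V, A ≤ x →
      (A.comap x.subtype ≤ h.comap x.subtype ↔ A ≤ h) := by
    intro A hA
    refine ⟨fun H v hv => H (show (⟨v, hA hv⟩ : x) ∈ A.comap x.subtype from hv),
      fun H => Submodule.comap_mono H⟩
  obtain ⟨m, hmS, hmh⟩ := exists_linearEquiv_map_hyperplane_eq (h := h.comap x.subtype)
    (S := (x ⊓ y).comap x.subtype) (S' := (x ⊓ y').comap x.subtype)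
    (by rw [hfr h hhx, hh]) (by rw [hfr _ inf_le_left, hfr _ inf_le_left, hd])
    (by rw [hcm _ inf_le_left, hcm _ inf_le_left, hle])
  let b := finBasis F x
  let b' := b.map m
  obtain ⟨f, hf, hfz⟩ := exists_frame hx hz hzx b
  obtain ⟨f', hf', hfz'⟩ := exists_frame hx hz' hzx' b'
  have hspan : Submodule.span F (Set.range fun i => (b i : V)) =
      Submodule.span F (Set.range fun i => (b' i : V)) := by
    rw [span_range_coe_basis, span_range_coe_basis]
  set g0 := P.frameMap (fun i => (b i : V)) f (fun i => (b' i : V)) f' with hg0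
  have hB : ∀ v w, P.B (g0 v) (g0 w) = P.B v w := B_frameMap hf hf' hspan
  have hQ : ∀ v, P.Q (g0 v) = P.Q v := Q_frameMap hf hf' hspan
  let g := LinearEquiv.ofInjectiveEndo g0 (injective_of_isometry hB hQ)
  have hgx : ∀ v : x, g0 v = m v := by
    intro v
    have h1 : ((v : V)) = Fintype.linearCombination F (fun i => (b i : V)) (b.repr v) := by
      conv_lhs => rw [← b.sum_repr v]
      rw [Submodule.coe_sum, Fintype.linearCombination_apply]
      rfl
    have h2 : ((m v : x) : V) = Fintype.linearCombination F (fun i => (b' i : V)) (b.repr v) := by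
      conv_lhs => rw [← b.sum_repr v]
      rw [map_sum, Submodule.coe_sum, Fintype.linearCombination_apply]
      refine Finset.sum_congr rfl fun i _ => ?_
      rw [map_smul]
      simp [b']
    rw [h2, h1]
    exact frameMap_left hf _
  have hmap : ∀ A A' : Submodule F V, A ≤ x →
      (A.comap x.subtype).map (m : x →ₗ[F] x) = A'.comap x.subtype →
      finrank F A' ≤ finrank F A → A.map (g : V →ₗ[F] V) = A' := by
    intro A A' hA hAm hfA
    refine Submodule.eq_of_le_of_finrank_le ?_ (by rw [LinearEquiv.finrank_map_eq]; exact hfA)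
    rintro _ ⟨v, hv, rfl⟩
    have h1 : m ⟨v, hA hv⟩ ∈ A'.comap x.subtype := by
      rw [← hAm]
      exact ⟨⟨v, hA hv⟩, hv, rfl⟩
    have h2 := hgx ⟨v, hA hv⟩
    have h3 : (g : V →ₗ[F] V) v = (m ⟨v, hA hv⟩ : x) := h2
    rw [h3]
    exact h1
  have hgS := hmap _ _ inf_le_left hmS hd.ge
  refine ⟨g, hB, hQ, ?_, hmap _ _ hhx hmh le_rfl, ?_⟩
  · refine hmap x x le_rfl ?_ le_rfl
    simp
  have hgz : ∀ v ∈ z, g0 v ∈ z' := by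
    intro v hv
    rw [← hfz, ← Fintype.range_linearCombination] at hv
    obtain ⟨a, rfl⟩ := hv
    rw [hg0, frameMap_right hf, ← hfz']
    exact lc_mem _ _
  have hsplit : ∀ {y z : Submodule F V}, Maximal P.IsIso y → z ⊓ x = ⊥ →
      finrank F x ≤ finrank F ↥(z ⊓ y) + finrank F ↥(x ⊓ y) → y = (x ⊓ y) ⊔ (z ⊓ y) := by
    intro y z hy hzx hzy
    symm
    refine Submodule.eq_of_le_of_finrank_le (sup_le inf_le_right inf_le_right) ?_
    have h1 := Submodule.finrank_sup_add_finrank_inf_eq (x ⊓ y) (z ⊓ y)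
    have h2 : (x ⊓ y) ⊓ (z ⊓ y) = ⊥ := by
      rw [eq_bot_iff, ← hzx]
      exact le_inf (inf_le_right.trans inf_le_left) (inf_le_left.trans inf_le_left)
    rw [h2, finrank_bot] at h1
    have := finrank_eq_of_maximal hx hy
    omega
  have e1 := hsplit hy hzx hzy
  have e2 := hsplit hy' hzx' hzy'
  refine Submodule.eq_of_le_of_finrank_le ?_ (by
    rw [LinearEquiv.finrank_map_eq, finrank_eq_of_maximal hy hy'])
  rw [e1, Submodule.map_sup, hgS]
  refine sup_le inf_le_right ?_
  rintro _ ⟨v, hv, rfl⟩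
  have hgv : (g : V →ₗ[F] V) v = g0 v := rfl
  rw [hgv]
  have hvz := hgz v hv.1
  -- The image of `z ⊓ y` lies in `z'`, so it is orthogonal to `z' ⊓ y'`; it is orthogonal to `x ⊓
  -- y'`, the image of `x ⊓ y`, because `y` is isotropic. These two pieces span `y'`.
  refine mem_of_mem_perp hy' (fun t ht => ?_) (hz'.prop.1 _ hvz) (hz'.prop.2 _ hvz _ hvz)
  rw [e2] at ht
  obtain ⟨s, hs, r, hr, rfl⟩ := Submodule.mem_sup.1 ht
  have h1 : P.B s (g0 v) = 0 := by
    rw [← hgS] at hs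
    obtain ⟨s, hs, rfl⟩ := hs
    exact (hB s v).trans (hy.prop.2 s hs.2 v hv.2)
  rw [map_add, LinearMap.add_apply, h1, hz'.prop.2 r hr.1 _ hvz, add_zero]

end PolarData
end

/-! ### The three types of forms in the common framework -/

noncomputable section

open Module

namespace PolarForm

variable {F V : Type*} [Field F] [AddCommGroup V] [Module F V]

/-- The uniform description of alternating, quadratic and Hermitian forms. -/
def data : PolarForm F V → PolarData F V
  | alternating B isAlt nondeg =>
    { σ := RingHom.id F
      κ := -1
      τ := 0
      B := B
      Q := 0
      σ_σ := fun _ => rfl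
      κ_ne_zero := by simp
      B_swap := fun v w => by
        rw [← LinearMap.IsAlt.neg isAlt v w]
        simp
      Q_add := by simp
      Q_smul := by simp
      exists_ne := fun u hu _ _ => by
        by_contra! h
        exact hu (nondeg.1 u h)
      exists_isotropic := fun u v _ _ _ => ⟨0, by simp, isAlt _⟩ }
  | quadratic Q nondeg =>
    { σ := RingHom.id F
      κ := 1
      τ := AddMonoidHom.id F
      B := QuadraticMap.polarBilin Q
      Q := Q
      σ_σ := fun _ => rfl
      κ_ne_zero := one_ne_zero
      B_swap := fun v w => by simp [QuadraticMap.polar_comm Q v w]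
      Q_add := fun v w => by simp [QuadraticMap.polar]
      Q_smul := fun c v h => by simp [QuadraticMap.map_smul, h]
      exists_ne := fun u hu hQ _ => by
        by_contra! h
        apply hu
        have h1 : u ∈ Q.radical := ⟨hQ, LinearMap.ext h⟩
        rw [nondeg.radical_eq_bot] at h1
        simpa using h1
      exists_isotropic := fun u v hQ _ huv => by
        have huv' : QuadraticMap.polar Q v u ≠ 0 := by
          rw [QuadraticMap.polar_comm]
          exact huv
        have h1 : Q (v + (-(Q v) / QuadraticMap.polar Q v u) • u) = 0 := by
          rw [QuadraticMap.map_add Q, QuadraticMap.map_smul, hQ, QuadraticMap.polar_smul_right]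
          simp only [smul_eq_mul]
          field_simp
          ring
        refine ⟨-(Q v) / QuadraticMap.polar Q v u, h1, ?_⟩
        rw [QuadraticMap.polarBilin_apply_apply, QuadraticMap.polar_self, h1]
        simp }
  | hermitian σ involutive nontrivial B isHermitian nondeg =>
    { σ := σ
      κ := 1
      τ := AddMonoidHom.id F + σ.toAddMonoidHom
      B := B
      Q := fun v => B v v
      σ_σ := involutive
      κ_ne_zero := one_ne_zero
      B_swap := fun v w => by simp [isHermitian]
      Q_add := fun v w => by
        simp only [map_add, LinearMap.add_apply, AddMonoidHom.add_apply, AddMonoidHom.id_apply,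
          RingHom.toAddMonoidHom_eq_coe, AddMonoidHom.coe_coe, isHermitian]
        ring
      Q_smul := fun c v h => by simp [h]
      exists_ne := fun u hu _ _ => by
        by_contra! h
        exact hu (nondeg.1 u h)
      exists_isotropic := fun u v hQ _ huv => by
        -- An element of non-zero trace: if all traces vanished, `a = 1` would give characteristic
        -- 2, and then `b + σ b = 0` would make `σ` trivial.
        obtain ⟨a, ha⟩ : ∃ a, a + σ a ≠ 0 := by
          by_contra! h
          apply nontrivial
          have h1 : (1 : F) + 1 = 0 := by simpa using h 1
          ext b
          have h2 : b + b = 0 := by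
            have := congrArg (b * ·) h1
            simpa [mul_add] using this
          exact (add_left_cancel (h2.trans (h b).symm)).symm
        have hvu : B v u ≠ 0 := fun h => huv (by rw [← isHermitian, h, map_zero])
        -- Chosen so that `c * B v u` has trace `-(B v v)`.
        set c := -(B v v) / (a + σ a) * a / B v u with hc
        have ht : σ (a + σ a) = a + σ a := by rw [map_add, involutive, add_comm]
        have h1 : c * B v u = -(B v v) / (a + σ a) * a := by
          rw [hc]
          field_simp
        have h2 : σ c * B u v = -(B v v) / (a + σ a) * σ a := by
          rw [← isHermitian v u, ← map_mul, h1, map_mul, map_div₀, map_neg, isHermitian, ht]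
        have h3 : B (v + c • u) (v + c • u) = 0 := by
          have h4 : B (v + c • u) (v + c • u) =
              B v v + c * B v u + σ c * B u v + σ c * (c * B u u) := by
            simp only [map_add, LinearMap.add_apply, map_smul, LinearMap.map_smulₛₗ,
              LinearMap.smul_apply, smul_eq_mul]
            ring
          rw [h4, h1, h2, hQ]
          field_simp
          ring
        exact ⟨c, h3, h3⟩ }

lemma isIsotropic_eq (φ : PolarForm F V) : φ.IsIsotropic = φ.data.IsIso := by
  ext U
  cases φ with
  | alternating B isAlt nondeg => exact ⟨fun h => ⟨fun _ _ => rfl, h⟩, fun h => h.2⟩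
  | quadratic Q nondeg =>
    refine ⟨fun h => ⟨h, fun v hv w hw => ?_⟩, fun h => h.1⟩
    change QuadraticMap.polar Q v w = 0
    rw [QuadraticMap.polar, h _ (U.add_mem hv hw), h v hv, h w hw]
    simp
  | hermitian σ involutive nontrivial B isHermitian nondeg =>
    exact ⟨fun h => ⟨fun v hv => h v hv v hv, h⟩, fun h => h.2⟩

/-! ### Distances, maximal cliques and symmetries of the dual polar graph -/

variable {φ : PolarForm F V}

lemma Vertex.maximal (x : φ.Vertex) : Maximal φ.data.IsIso x.1 := by
  rw [← isIsotropic_eq]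
  exact x.2

/-- A maximal isotropic subspace as a vertex. -/
def mkVertex {U : Submodule F V} (h : Maximal φ.data.IsIso U) : φ.Vertex :=
  ⟨U, by rw [isIsotropic_eq]; exact h⟩

variable [FiniteDimensional F V]

lemma finrank_vertex (x : φ.Vertex) : finrank F x.1 = φ.wittIndex := by
  have hle : ∀ d ∈ {d | ∃ U : Submodule F V, φ.IsIsotropic U ∧ finrank F U = d},
      d ≤ finrank F x.1 := by
    rintro _ ⟨U, hU, rfl⟩
    rw [isIsotropic_eq] at hU
    exact hU.finrank_le x.maximal
  exact le_antisymm (le_csSup ⟨_, hle⟩ ⟨x.1, x.2.prop, rfl⟩)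
    (csSup_le ⟨_, x.1, x.2.prop, rfl⟩ hle)

lemma finrank_inf_lt {y z : φ.Vertex} (h : y ≠ z) :
    finrank F ↥(y.1 ⊓ z.1) < φ.wittIndex := by
  rw [← finrank_vertex y]
  refine Submodule.finrank_lt_finrank_of_lt (lt_of_le_of_ne inf_le_left fun h1 => h ?_)
  exact Subtype.ext (y.2.eq_of_le z.2.prop (inf_eq_left.1 h1))

/-- For a hyperplane `H` of `y` containing `y ∩ z`, the vertex `H + (z ∩ H^⊥)` is adjacent to `y`
and meets `z` in a larger dimension. -/
lemma exists_walk {n : ℕ} {y z : φ.Vertex}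
    (h : φ.wittIndex ≤ finrank F ↥(y.1 ⊓ z.1) + n) :
    ∃ p : φ.dualPolarGraph.Walk y z, p.length ≤ n := by
  induction n generalizing y with
  | zero =>
    obtain rfl : y = z := by
      by_contra hne
      have := finrank_inf_lt hne
      omega
    exact ⟨.nil, le_rfl⟩
  | succ n ih =>
    by_cases hne : y = z
    · subst hne
      exact ⟨.nil, Nat.zero_le _⟩
    have hlt : y.1 ⊓ z.1 < y.1 := lt_of_le_of_ne inf_le_left fun h1 => hne
      (Subtype.ext (y.2.eq_of_le z.2.prop (inf_eq_left.1 h1)))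
    obtain ⟨u, hu, huA⟩ := SetLike.exists_of_lt hlt
    obtain ⟨H, hAH, hHy, -, hH⟩ := PolarData.exists_hyperplane_notMem inf_le_left hu huA
    have hHiso := y.maximal.prop.mono hHy
    let w : φ.Vertex := mkVertex (PolarData.maximal_sup_inf_perp hHiso z.maximal)
    have hHw : H ≤ w.1 := le_sup_left
    have h1 := PolarData.finrank_le_inf_perp z.maximal.prop H
    have h2 : finrank F ↥(z.1 ⊓ φ.data.perp H) ≤ finrank F ↥(w.1 ⊓ z.1) :=
      Submodule.finrank_mono (le_inf le_sup_right inf_le_left)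
    have h3 : finrank F ↥(y.1 ⊓ z.1) ≤ finrank F ↥(H ⊓ z.1) :=
      Submodule.finrank_mono (le_inf hAH inf_le_right)
    rw [finrank_vertex] at h1 hH
    have hyw : y ≠ w := by
      intro h4
      rw [← h4] at h2
      omega
    have h5 : finrank F H ≤ finrank F ↥(y.1 ⊓ w.1) := Submodule.finrank_mono (le_inf hHy hHw)
    have h6 := finrank_inf_lt hyw
    obtain ⟨p, hp⟩ := ih (y := w) (by omega)
    have hadj : φ.dualPolarGraph.Adj y w := ⟨hyw, by omega⟩
    exact ⟨.cons hadj p, Nat.succ_le_succ hp⟩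

/-- For an edge from `y` to `w`, `y ∩ w` is a hyperplane of `w`, so it meets `w ∩ z` in codimension
at most one: each edge changes the bound by at most one. -/
lemma wittIndex_le_of_walk {y z : φ.Vertex} (p : φ.dualPolarGraph.Walk y z) :
    φ.wittIndex ≤ finrank F ↥(y.1 ⊓ z.1) + p.length := by
  induction p with
  | nil => rw [inf_idem, finrank_vertex]; exact Nat.le_add_right _ _
  | @cons y w z h p ih =>
    have h1 := h.2
    have h2 := Submodule.finrank_sup_add_finrank_inf_eq (y.1 ⊓ w.1) (w.1 ⊓ z.1)
    have h3 : finrank F ↥((y.1 ⊓ w.1) ⊔ (w.1 ⊓ z.1)) ≤ finrank F w.1 :=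
      Submodule.finrank_mono (sup_le inf_le_right inf_le_left)
    have h4 : finrank F ↥((y.1 ⊓ w.1) ⊓ (w.1 ⊓ z.1)) ≤ finrank F ↥(y.1 ⊓ z.1) :=
      Submodule.finrank_mono (inf_le_inf inf_le_left inf_le_right)
    rw [finrank_vertex] at h3
    rw [SimpleGraph.Walk.length_cons]
    omega

lemma dist_add_finrank (y z : φ.Vertex) :
    φ.dualPolarGraph.dist y z + finrank F ↥(y.1 ⊓ z.1) = φ.wittIndex := by
  have hle : finrank F ↥(y.1 ⊓ z.1) ≤ φ.wittIndex := by
    rw [← finrank_vertex y]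
    exact Submodule.finrank_mono inf_le_left
  obtain ⟨p, hp⟩ := exists_walk (y := y) (z := z)
    (n := φ.wittIndex - finrank F ↥(y.1 ⊓ z.1)) (by omega)
  have h1 := SimpleGraph.dist_le p
  obtain ⟨p', hp'⟩ := p.reachable.exists_walk_length_eq_dist
  have h2 := wittIndex_le_of_walk p'
  omega

lemma isClique_setOf_le {h : Submodule F V} (hd : finrank F h + 1 = φ.wittIndex) :
    φ.dualPolarGraph.IsClique {z | h ≤ z.1} := by
  intro y hy z hz hne
  have h1 := finrank_inf_lt hne
  have h2 : finrank F h ≤ finrank F ↥(y.1 ⊓ z.1) := Submodule.finrank_mono (le_inf hy hz)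
  exact ⟨hne, by omega⟩

/-- Otherwise `y = (x ∩ y) + (y ∩ z)`, and any vector of `x ∩ z` is orthogonal to both summands.
Maximality of `y` then forces `x ∩ z ≤ y`, and a dimension count puts `x ∩ y` inside `z` after all.
-/
lemma inf_le_of_adj {x y z : φ.Vertex} (hxy : φ.dualPolarGraph.Adj x y)
    (hxz : φ.dualPolarGraph.Adj x z) (hyz : φ.dualPolarGraph.Adj y z) : x.1 ⊓ y.1 ≤ z.1 := by
  by_contra hc
  have hxy' := hxy.2
  have hxz' := hxz.2
  have hyz' := hyz.2
  have h1 : ¬ x.1 ⊓ z.1 ≤ y.1 := by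
    intro h
    apply hc
    rw [← Submodule.eq_of_le_of_finrank_le (le_inf inf_le_left h) (by omega)]
    exact inf_le_right
  have h2 : ¬ y.1 ⊓ z.1 ≤ x.1 ⊓ y.1 := by
    intro h
    apply hc
    rw [← Submodule.eq_of_le_of_finrank_le h (by omega)]
    exact inf_le_right
  obtain ⟨u, hu, huy⟩ := SetLike.not_le_iff_exists.1 h1
  have hlt : x.1 ⊓ y.1 < (x.1 ⊓ y.1) ⊔ (y.1 ⊓ z.1) :=
    lt_of_le_of_ne le_sup_left fun h => h2 (by rw [h]; exact le_sup_right)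
  have hy : (x.1 ⊓ y.1) ⊔ (y.1 ⊓ z.1) = y.1 := by
    refine Submodule.eq_of_le_of_finrank_le (sup_le inf_le_right inf_le_left) ?_
    have := Submodule.finrank_lt_finrank_of_lt hlt
    rw [finrank_vertex]
    omega
  apply huy
  refine PolarData.mem_of_mem_perp y.maximal (fun t ht => ?_) (x.maximal.prop.1 u hu.1)
    (x.maximal.prop.2 u hu.1 u hu.1)
  rw [← hy] at ht
  obtain ⟨a, ha, b, hb, rfl⟩ := Submodule.mem_sup.1 ht
  rw [map_add, LinearMap.add_apply, x.maximal.prop.2 a ha.1 u hu.1,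
    z.maximal.prop.2 b hb.2 u hu.2, add_zero]

/-- The maximal cliques of the dual polar graph are the sets of vertices containing a given
isotropic subspace of codimension one. -/
lemma exists_eq_setOf_le (hD : 0 < φ.wittIndex) {C : Set φ.Vertex}
    (hC : Maximal φ.dualPolarGraph.IsClique C) {x : φ.Vertex} (hx : x ∈ C) :
    ∃ h ≤ x.1, finrank F h + 1 = φ.wittIndex ∧ C = {z | h ≤ z.1} := by
  obtain ⟨y, hy, hxy⟩ : ∃ y ∈ C, x ≠ y := by
    -- A singleton is not a maximal clique: a hyperplane of `x` lies in a second vertex.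
    by_contra! hc
    have hCx : C = {x} := Set.eq_singleton_iff_unique_mem.2 ⟨hx, fun z hz => (hc z hz).symm⟩
    have hbot : x.1 ≠ ⊥ := by
      intro h0
      have := finrank_vertex x
      rw [h0, finrank_bot] at this
      omega
    obtain ⟨u, hu, hu0⟩ := Submodule.exists_mem_ne_zero_of_ne_bot hbot
    obtain ⟨H, -, hHx, -, hH⟩ := PolarData.exists_hyperplane_notMem (F := F) bot_le hu
      (by simpa using hu0)
    obtain ⟨w, hw, hwx⟩ := PolarData.exists_maximal_inf_eq x.maximal hHx hH
    rw [finrank_vertex] at hH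
    have h1 := hC.eq_of_subset (isClique_setOf_le hH) (by
      rw [hCx, Set.singleton_subset_iff]
      exact hHx)
    have h2 : mkVertex hw ∈ C := by
      rw [h1]
      exact (hwx ▸ inf_le_left : H ≤ w)
    have h3 : w = x.1 := congrArg Subtype.val (hc _ h2).symm
    rw [h3, inf_idem] at hwx
    have := finrank_vertex x
    rw [hwx] at this
    omega
  have hadj := hC.prop hx hy hxy
  have hsub : C ⊆ {z | x.1 ⊓ y.1 ≤ z.1} := by
    intro z hz
    by_cases hzx : x = z
    · subst hzx
      exact (inf_le_left : x.1 ⊓ y.1 ≤ x.1)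
    by_cases hzy : y = z
    · subst hzy
      exact (inf_le_right : x.1 ⊓ y.1 ≤ y.1)
    exact inf_le_of_adj hadj (hC.prop hx hz hzx) (hC.prop hy hz hzy)
  exact ⟨x.1 ⊓ y.1, inf_le_left, hadj.2, hC.eq_of_subset (isClique_setOf_le hadj.2) hsub⟩

/-- For `z ≥ h`, `dim (y ∩ z)` exceeds `dim (h ∩ y)` by at most one, since `h` is a hyperplane of
`z`. The projection `h + (y ∩ h^⊥)` attains this bound, so it is a nearest point of the clique. -/
lemma distToSet_add_finrank {h : Submodule F V} {x : φ.Vertex} (hx : h ≤ x.1)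
    (hd : finrank F h + 1 = φ.wittIndex) (y : φ.Vertex) :
    φ.dualPolarGraph.distToSet y {z | h ≤ z.1} + (finrank F ↥(h ⊓ y.1) + 1) = φ.wittIndex := by
  let p : φ.Vertex :=
    mkVertex (PolarData.maximal_sup_inf_perp (x.maximal.prop.mono hx) y.maximal)
  have hp : h ≤ p.1 := le_sup_left
  have hbound : ∀ z : φ.Vertex, h ≤ z.1 →
      finrank F ↥(y.1 ⊓ z.1) ≤ finrank F ↥(h ⊓ y.1) + 1 := by
    intro z hz
    have h1 := Submodule.finrank_sup_add_finrank_inf_eq (y.1 ⊓ z.1) h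
    have h2 : finrank F ↥((y.1 ⊓ z.1) ⊔ h) ≤ finrank F z.1 :=
      Submodule.finrank_mono (sup_le inf_le_right hz)
    have h3 : finrank F ↥((y.1 ⊓ z.1) ⊓ h) ≤ finrank F ↥(h ⊓ y.1) :=
      Submodule.finrank_mono (le_inf inf_le_right (inf_le_left.trans inf_le_left))
    rw [finrank_vertex] at h2
    omega
  have hpe : finrank F ↥(h ⊓ y.1) + 1 ≤ finrank F ↥(y.1 ⊓ p.1) := by
    have h1 := PolarData.finrank_le_inf_perp y.maximal.prop h
    have h2 : finrank F ↥(y.1 ⊓ φ.data.perp h) ≤ finrank F ↥(y.1 ⊓ p.1) :=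
      Submodule.finrank_mono (le_inf inf_le_left le_sup_right)
    rw [finrank_vertex] at h1
    omega
  have hleast : IsLeast ((fun z => φ.dualPolarGraph.dist y z) '' {z | h ≤ z.1})
      (φ.dualPolarGraph.dist y p) := by
    refine ⟨⟨p, hp, rfl⟩, ?_⟩
    rintro _ ⟨z, hz, rfl⟩
    have h1 := dist_add_finrank y z
    have h2 := dist_add_finrank y p
    have h3 := hbound z hz
    simp only
    omega
  rw [SimpleGraph.distToSet, hleast.csInf_eq]
  have h2 := dist_add_finrank y p
  have h3 := hbound p hp
  omega

/-- The action of an isometry on the vertices of the dual polar graph. -/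
lemma exists_equiv_of_isometry (g : V ≃ₗ[F] V)
    (hB : ∀ v w, φ.data.B (g v) (g w) = φ.data.B v w) (hQ : ∀ v, φ.data.Q (g v) = φ.data.Q v) :
    ∃ π : φ.Vertex ≃ φ.Vertex, ∀ y : φ.Vertex, (π y).1 = y.1.map (g : V →ₗ[F] V) := by
  have hmax : ∀ g : V ≃ₗ[F] V, (∀ v w, φ.data.B (g v) (g w) = φ.data.B v w) →
      (∀ v, φ.data.Q (g v) = φ.data.Q v) → ∀ y : φ.Vertex,
      Maximal φ.data.IsIso (y.1.map (g : V →ₗ[F] V)) := by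
    intro g hB hQ y
    have hiso : φ.data.IsIso (y.1.map (g : V →ₗ[F] V)) := by
      constructor
      · rintro _ ⟨v, hv, rfl⟩
        exact (hQ v).trans (y.maximal.prop.1 v hv)
      · rintro _ ⟨v, hv, rfl⟩ _ ⟨w, hw, rfl⟩
        exact (hB v w).trans (y.maximal.prop.2 v hv w hw)
    exact hiso.maximal y.maximal (by rw [LinearEquiv.finrank_map_eq])
  refine ⟨⟨fun y => mkVertex (hmax g hB hQ y), fun y => mkVertex (hmax g.symm
    (fun v w => by rw [← hB]; simp) (fun v => by rw [← hQ]; simp) y), fun y => ?_, fun y => ?_⟩,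
    fun y => rfl⟩
  · apply Subtype.ext
    change (y.1.map (g : V →ₗ[F] V)).map (g.symm : V →ₗ[F] V) = y.1
    rw [← Submodule.map_comp]
    simp
  · apply Subtype.ext
    change (y.1.map (g.symm : V →ₗ[F] V)).map (g : V →ₗ[F] V) = y.1
    rw [← Submodule.map_comp]
    simp

/-- The stabilizer of a flag `(x, h)` in the isometry group acts transitively on each set of
vertices at given distances from `x` and from the maximal clique belonging to `h`. -/
theorem exists_equiv {h : Submodule F V} {x : φ.Vertex} (hx : h ≤ x.1)
    (hd : finrank F h + 1 = φ.wittIndex) {y y' : φ.Vertex}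
    (h1 : φ.dualPolarGraph.dist x y = φ.dualPolarGraph.dist x y')
    (h2 : φ.dualPolarGraph.distToSet y {z | h ≤ z.1} =
      φ.dualPolarGraph.distToSet y' {z | h ≤ z.1}) :
    ∃ π : φ.Vertex ≃ φ.Vertex,
      (∀ a b, φ.dualPolarGraph.dist (π a) (π b) = φ.dualPolarGraph.dist a b) ∧ π x = x ∧
        (∀ z, π z ∈ {z : φ.Vertex | h ≤ z.1} ↔ z ∈ {z : φ.Vertex | h ≤ z.1}) ∧ π y = y' := by
  have e1 := dist_add_finrank x y
  have e2 := dist_add_finrank x y'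
  have e3 := distToSet_add_finrank hx hd y
  have e4 := distToSet_add_finrank hx hd y'
  -- As `h ≤ x`, the inclusion `x ∩ w ≤ h` depends on dimensions only, hence on the two distances.
  have hle : ∀ w : φ.Vertex, x.1 ⊓ w.1 ≤ h ↔
      finrank F ↥(x.1 ⊓ w.1) ≤ finrank F ↥(h ⊓ w.1) := by
    intro w
    refine ⟨fun H => Submodule.finrank_mono (le_inf H inf_le_right), fun H => ?_⟩
    rw [← Submodule.eq_of_le_of_finrank_le (inf_le_inf_right w.1 hx) H]
    exact inf_le_left
  obtain ⟨g, hB, hQ, hgx, hgh, hgy⟩ := PolarData.exists_isometry x.maximal hx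
    (by rw [finrank_vertex, hd]) y.maximal y'.maximal (by omega) (by
      rw [hle, hle, show finrank F ↥(x.1 ⊓ y.1) = finrank F ↥(x.1 ⊓ y'.1) by omega,
        show finrank F ↥(h ⊓ y.1) = finrank F ↥(h ⊓ y'.1) by omega])
  obtain ⟨π, hπ⟩ := exists_equiv_of_isometry g hB hQ
  refine ⟨π, fun a b => ?_, Subtype.ext (by rw [hπ, hgx]), fun z => ?_,
    Subtype.ext (by rw [hπ, hgy])⟩
  · have h3 := dist_add_finrank (π a) (π b)
    have h4 := dist_add_finrank a b
    rw [hπ, hπ, ← Submodule.map_inf _ g.injective, LinearEquiv.finrank_map_eq] at h3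
    omega
  · change h ≤ (π z).1 ↔ h ≤ z.1
    conv_lhs => rw [hπ, ← hgh]
    exact Submodule.map_le_map_iff_of_injective g.injective _ _

/-- Since `h` is a hyperplane of `x`, `dim (x ∩ y) - dim (h ∩ y)` is 1 or 0; these cases give
`C_i^-` and `C_i^+` respectively. -/
lemma exists_mem_cell {h : Submodule F V} {x : φ.Vertex} (hx : h ≤ x.1)
    (hd : finrank F h + 1 = φ.wittIndex) (y : φ.Vertex) :
    ∃ i < φ.wittIndex, y ∈ φ.dualPolarGraph.cellMinus x {z | h ≤ z.1} i ∨
      y ∈ φ.dualPolarGraph.cellPlus x {z | h ≤ z.1} i := by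
  have e1 := dist_add_finrank x y
  have e3 := distToSet_add_finrank hx hd y
  have h1 : finrank F ↥(h ⊓ y.1) ≤ finrank F ↥(x.1 ⊓ y.1) :=
    Submodule.finrank_mono (inf_le_inf_right _ hx)
  have h2 := Submodule.finrank_sup_add_finrank_inf_eq (x.1 ⊓ y.1) h
  have h3 : finrank F ↥((x.1 ⊓ y.1) ⊔ h) ≤ finrank F x.1 :=
    Submodule.finrank_mono (sup_le inf_le_left hx)
  have h4 : finrank F ↥((x.1 ⊓ y.1) ⊓ h) ≤ finrank F ↥(h ⊓ y.1) :=
    Submodule.finrank_mono (le_inf inf_le_right (inf_le_left.trans inf_le_right))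
  rw [finrank_vertex] at h3
  refine ⟨φ.dualPolarGraph.distToSet y {z | h ≤ z.1}, by omega, ?_⟩
  have h5 : φ.dualPolarGraph.dist x y = φ.dualPolarGraph.distToSet y {z | h ≤ z.1} ∨
      φ.dualPolarGraph.dist x y = φ.dualPolarGraph.distToSet y {z | h ≤ z.1} + 1 := by omega
  exact h5.imp (fun H => ⟨H, rfl⟩) (fun H => ⟨H, rfl⟩)

end PolarForm
end

/-! ### Functions constant on cells as an irreducible module -/

noncomputable section

namespace SimpleGraph

variable {X : Type*} (Γ : SimpleGraph X) (x : X) (C : Set X)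

/-- The cell of `y`: the vertices at the same distances from `x` and from `C` as `y`. -/
def cell (y : X) : Set X := Γ.sphere x (Γ.dist x y) ∩ Γ.distNeighbor C (Γ.distToSet y C)

/-- The functions constant on all cells. -/
def cellConstant : Submodule ℂ (X → ℂ) where
  carrier := {v | ∀ y, ∀ z ∈ Γ.cell x C y, v z = v y}
  zero_mem' := fun _ _ _ => rfl
  add_mem' := fun hv hw y z hz => by
    rw [Pi.add_apply, Pi.add_apply, hv y z hz, hw y z hz]
  smul_mem' := fun c v hv y z hz => by
    rw [Pi.smul_apply, Pi.smul_apply, hv y z hz]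

variable {Γ x C}

lemma mem_cell_self (y : X) : y ∈ Γ.cell x C y := ⟨rfl, rfl⟩

lemma mem_cell_comm {y z : X} : z ∈ Γ.cell x C y ↔ y ∈ Γ.cell x C z :=
  ⟨fun h => ⟨Eq.symm h.1, Eq.symm h.2⟩, fun h => ⟨Eq.symm h.1, Eq.symm h.2⟩⟩

lemma charVec_apply (Y : Set X) (y : X) [Decidable (y ∈ Y)] :
    charVec Y y = if y ∈ Y then 1 else 0 := by
  rw [charVec, Set.indicator_apply]
  rfl

lemma charVec_sphere_mem (i : ℕ) : charVec (Γ.sphere x i) ∈ Γ.cellConstant x C := by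
  classical
  intro y z hz
  have h : Γ.dist x z = Γ.dist x y := hz.1
  simp [charVec_apply, sphere, h]

lemma charVec_distNeighbor_mem (i : ℕ) :
    charVec (Γ.distNeighbor C i) ∈ Γ.cellConstant x C := by
  classical
  intro y z hz
  have h : Γ.distToSet z C = Γ.distToSet y C := hz.2
  simp [charVec_apply, distNeighbor, h]

lemma mul_mem_cellConstant {v w : X → ℂ} (hv : v ∈ Γ.cellConstant x C)
    (hw : w ∈ Γ.cellConstant x C) : v * w ∈ Γ.cellConstant x C := fun y z hz => by
  rw [Pi.mul_apply, Pi.mul_apply, hv y z hz, hw y z hz]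

lemma charVec_inter (Y Z : Set X) : charVec (Y ∩ Z) = charVec Y * charVec Z := by
  classical
  ext y
  simp only [charVec_apply, Pi.mul_apply, Set.mem_inter_iff]
  by_cases h1 : y ∈ Y <;> by_cases h2 : y ∈ Z <;> simp [h1, h2]

variable [Fintype X]

/-- The sum runs over vertices rather than cells, so each cell occurs once per element; dividing by
its size compensates. -/
lemma eq_sum_charVec_cell {v : X → ℂ} (hv : v ∈ Γ.cellConstant x C) :
    v = ∑ y, (v y / ((Γ.cell x C y).ncard : ℂ)) • charVec (Γ.cell x C y) := by
  classical
  ext z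
  have h1 : ∀ y, ((v y / ((Γ.cell x C y).ncard : ℂ)) • charVec (Γ.cell x C y)) z =
      if y ∈ Γ.cell x C z then v z / ((Γ.cell x C z).ncard : ℂ) else 0 := by
    intro y
    rw [Pi.smul_apply, charVec_apply, smul_eq_mul, mul_ite, mul_one, mul_zero]
    by_cases h : z ∈ Γ.cell x C y
    · have hyz := mem_cell_comm.1 h
      have hc : Γ.cell x C y = Γ.cell x C z := by
        rw [cell, cell, show Γ.dist x y = Γ.dist x z from hyz.1,
          show Γ.distToSet y C = Γ.distToSet z C from hyz.2]
      rw [if_pos h, if_pos hyz, hc, hv y z h]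
    · rw [if_neg h, if_neg (fun h' => h (mem_cell_comm.1 h'))]
  rw [Finset.sum_apply, Finset.sum_congr rfl fun y _ => h1 y, Finset.sum_ite, Finset.sum_const,
    Finset.sum_const_zero, add_zero, nsmul_eq_mul]
  have h2 : (Finset.univ.filter fun y => y ∈ Γ.cell x C z).card = (Γ.cell x C z).ncard := by
    rw [← Set.ncard_coe_finset]
    simp
  have h3 : ((Γ.cell x C z).ncard : ℂ) ≠ 0 := by
    exact Nat.cast_ne_zero.2 (Set.ncard_ne_zero_of_mem (mem_cell_self z))
  rw [h2]
  field_simp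

lemma primarySubspace_eq {D : ℕ}
    (hcover : ∀ y, ∃ i < D, y ∈ Γ.cellMinus x C i ∨ y ∈ Γ.cellPlus x C i) :
    Γ.primarySubspace D x C = Γ.cellConstant x C := by
  apply le_antisymm
  · rw [primarySubspace, Submodule.span_le]
    rintro v ⟨i, -, rfl | rfl⟩
    · rw [cellMinus, charVec_inter]
      exact mul_mem_cellConstant (charVec_sphere_mem _) (charVec_distNeighbor_mem _)
    · rw [cellPlus, charVec_inter]
      exact mul_mem_cellConstant (charVec_sphere_mem _) (charVec_distNeighbor_mem _)
  · intro v hv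
    rw [eq_sum_charVec_cell hv]
    refine Submodule.sum_mem _ fun y _ => Submodule.smul_mem _ _ (Submodule.subset_span ?_)
    obtain ⟨i, hi, hy⟩ := hcover y
    refine ⟨i, hi, hy.imp (fun h => ?_) (fun h => ?_)⟩
    · rw [cell, cellMinus, show Γ.dist x y = i from h.1, show Γ.distToSet y C = i from h.2]
    · rw [cell, cellPlus, show Γ.dist x y = i + 1 from h.1, show Γ.distToSet y C = i from h.2]

variable [DecidableEq X]

/-- The matrices leaving a subspace invariant. -/
def stabilizerSubalgebra (W : Submodule ℂ (X → ℂ)) : Subalgebra ℂ (Matrix X X ℂ) where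
  carrier := {M | ∀ v ∈ W, M.mulVec v ∈ W}
  mul_mem' := fun {M N} hM hN v hv => by
    rw [← Matrix.mulVec_mulVec]
    exact hM _ (hN v hv)
  add_mem' := fun {M N} hM hN v hv => by
    rw [Matrix.add_mulVec]
    exact W.add_mem (hM v hv) (hN v hv)
  algebraMap_mem' := fun c v hv => by
    rw [Algebra.algebraMap_eq_smul_one, Matrix.smul_mulVec, Matrix.one_mulVec]
    exact W.smul_mem c hv

lemma diagonal_mem_stabilizer {w : X → ℂ} (hw : w ∈ Γ.cellConstant x C) :
    Matrix.diagonal w ∈ stabilizerSubalgebra (Γ.cellConstant x C) := by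
  intro v hv
  have : (Matrix.diagonal w).mulVec v = w * v := by
    ext y
    rw [Matrix.mulVec_diagonal, Pi.mul_apply]
  rw [this]
  exact mul_mem_cellConstant hw hv

/-- Reindexing the sum for `(A_i v)(π y)` by `π` gives `(A_i v)(y)`, because `π` preserves distances
and maps each cell to itself. -/
lemma distMatrix_mem_stabilizer
    (htrans : ∀ y, ∀ z ∈ Γ.cell x C y, ∃ π : X ≃ X,
      (∀ a b, Γ.dist (π a) (π b) = Γ.dist a b) ∧ π x = x ∧ (∀ c, π c ∈ C ↔ c ∈ C) ∧ π y = z)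
    (i : ℕ) : Γ.distMatrix i ∈ stabilizerSubalgebra (Γ.cellConstant x C) := by
  classical
  intro v hv y z hz
  obtain ⟨π, hdist, hx, hC, rfl⟩ := htrans y z hz
  rw [Matrix.mulVec, Matrix.mulVec, dotProduct, dotProduct]
  refine (Fintype.sum_equiv π _ _ fun w => ?_).symm
  have hset : Γ.distToSet (π w) C = Γ.distToSet w C := by
    rw [distToSet, distToSet]
    congr 1
    ext n
    constructor
    · rintro ⟨c, hc, rfl⟩
      refine ⟨π.symm c, by rwa [← hC, Equiv.apply_symm_apply], ?_⟩
      simp only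
      rw [← hdist, Equiv.apply_symm_apply]
    · rintro ⟨c, hc, rfl⟩
      exact ⟨π c, (hC c).2 hc, hdist w c⟩
  have hcell : π w ∈ Γ.cell x C w := by
    refine ⟨?_, hset⟩
    change Γ.dist x (π w) = Γ.dist x w
    conv_lhs => rw [← hx, hdist]
  rw [hv w _ hcell]
  simp [distMatrix, hdist]

lemma generalizedTerwilliger_le_stabilizer
    (htrans : ∀ y, ∀ z ∈ Γ.cell x C y, ∃ π : X ≃ X,
      (∀ a b, Γ.dist (π a) (π b) = Γ.dist a b) ∧ π x = x ∧ (∀ c, π c ∈ C ↔ c ∈ C) ∧ π y = z) :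
    Γ.generalizedTerwilliger x C ≤ stabilizerSubalgebra (Γ.cellConstant x C) := by
  have h1 : Γ.boseMesner ≤ stabilizerSubalgebra (Γ.cellConstant x C) := by
    refine Algebra.adjoin_le ?_
    rintro _ ⟨i, rfl⟩
    exact distMatrix_mem_stabilizer htrans i
  refine sup_le (sup_le h1 (Algebra.adjoin_le ?_)) (sup_le h1 (Algebra.adjoin_le ?_))
  · rintro _ ⟨i, rfl⟩
    exact diagonal_mem_stabilizer (charVec_sphere_mem i)
  · rintro _ ⟨i, rfl⟩
    exact diagonal_mem_stabilizer (charVec_distNeighbor_mem i)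

lemma diagonal_cell_mem (y : X) :
    Matrix.diagonal (charVec (Γ.cell x C y)) ∈ Γ.generalizedTerwilliger x C := by
  have h1 : Matrix.diagonal (charVec (Γ.sphere x (Γ.dist x y))) ∈
      Γ.generalizedTerwilliger x C :=
    (le_sup_right.trans le_sup_left : Γ.dualBoseMesner x ≤ _)
      (Algebra.subset_adjoin ⟨_, rfl⟩)
  have h2 : Matrix.diagonal (charVec (Γ.distNeighbor C (Γ.distToSet y C))) ∈
      Γ.generalizedTerwilliger x C :=
    (le_sup_right.trans le_sup_right : Γ.dualBoseMesnerSet C ≤ _)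
      (Algebra.subset_adjoin ⟨_, rfl⟩)
  have h3 := Subalgebra.mul_mem _ h1 h2
  rw [Matrix.diagonal_mul_diagonal] at h3
  rwa [cell, charVec_inter]

lemma allOnes_mem : (Matrix.of fun _ _ => 1 : Matrix X X ℂ) ∈ Γ.generalizedTerwilliger x C := by
  classical
  obtain ⟨n, hn⟩ : ∃ n, ∀ y z, Γ.dist y z < n := by
    obtain ⟨n, hn⟩ := (Set.finite_range fun p : X × X => Γ.dist p.1 p.2).bddAbove
    exact ⟨n + 1, fun y z => Nat.lt_succ_of_le (hn ⟨(y, z), rfl⟩)⟩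
  have h1 : (Matrix.of fun _ _ => 1 : Matrix X X ℂ) = ∑ i ∈ Finset.range n, Γ.distMatrix i := by
    ext y z
    rw [Matrix.sum_apply]
    simp [distMatrix, hn y z]
  rw [h1]
  refine Subalgebra.sum_mem _ fun i _ => ?_
  exact (le_sup_left.trans le_sup_left : Γ.boseMesner ≤ _) (Algebra.subset_adjoin ⟨i, rfl⟩)

/-- If the automorphisms fixing `x` and `C` act transitively on the cells, then the functions
constant on cells form an irreducible module of the generalized Terwilliger algebra. -/
theorem exists_simple_submodule
    (htrans : ∀ y, ∀ z ∈ Γ.cell x C y, ∃ π : X ≃ X,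
      (∀ a b, Γ.dist (π a) (π b) = Γ.dist a b) ∧ π x = x ∧ (∀ c, π c ∈ C ↔ c ∈ C) ∧ π y = z) :
    ∃ W : Submodule (Γ.generalizedTerwilliger x C) (X → ℂ),
      (W : Set (X → ℂ)) = Γ.cellConstant x C ∧
        IsSimpleModule (Γ.generalizedTerwilliger x C) W := by
  classical
  let W : Submodule (Γ.generalizedTerwilliger x C) (X → ℂ) :=
    { carrier := Γ.cellConstant x C
      zero_mem' := Submodule.zero_mem _
      add_mem' := Submodule.add_mem _
      smul_mem' := fun M v hv => generalizedTerwilliger_le_stabilizer htrans M.2 v hv }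
  refine ⟨W, rfl, ?_⟩
  have hone : (fun _ => 1 : X → ℂ) ∈ Γ.cellConstant x C := fun _ _ _ => rfl
  rw [isSimpleModule_iff_isAtom]
  constructor
  · intro h0
    have h1 : (fun _ => 1 : X → ℂ) ∈ W := hone
    rw [h0, Submodule.mem_bot] at h1
    exact one_ne_zero (congrFun h1 x)
  · intro N hN
    by_contra hbot
    obtain ⟨v, hv, hv0⟩ := Submodule.exists_mem_ne_zero_of_ne_bot hbot
    obtain ⟨y, hy⟩ := Function.ne_iff.1 hv0
    have hvW : v ∈ Γ.cellConstant x C := hN.le hv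
    have hmul : ∀ M ∈ Γ.generalizedTerwilliger x C, ∀ w ∈ N, M.mulVec w ∈ N :=
      fun M hM w hw => N.smul_mem ⟨M, hM⟩ hw
    have hsmul : ∀ (c : ℂ), ∀ w ∈ N, c • w ∈ N := by
      intro c w hw
      have := hmul _ (Subalgebra.algebraMap_mem _ c) w hw
      rwa [Algebra.algebraMap_eq_smul_one, Matrix.smul_mulVec, Matrix.one_mulVec] at this
    -- Projecting to the cell of `y` leaves the constant `v y` there; the all-ones matrix spreads `v
    -- y` times the cell size over all vertices.
    have h1 := hmul _ allOnes_mem _ (hmul _ (diagonal_cell_mem y) v hv)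
    have h2 : (Matrix.of fun _ _ => 1 : Matrix X X ℂ).mulVec
        ((Matrix.diagonal (charVec (Γ.cell x C y))).mulVec v) =
        fun _ => v y * ((Γ.cell x C y).ncard : ℂ) := by
      ext z
      simp only [Matrix.mulVec, dotProduct, Matrix.of_apply, one_mul]
      have h3 : ∀ w, ∑ u, Matrix.diagonal (charVec (Γ.cell x C y)) w u * v u =
          if w ∈ Γ.cell x C y then v y else 0 := by
        intro w
        have := Matrix.mulVec_diagonal (charVec (Γ.cell x C y)) v w
        rw [Matrix.mulVec, dotProduct] at this
        rw [this, charVec_apply, ite_mul, one_mul, zero_mul]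
        by_cases h : w ∈ Γ.cell x C y
        · rw [if_pos h, if_pos h, hvW y w h]
        · rw [if_neg h, if_neg h]
      rw [Finset.sum_congr rfl fun w _ => h3 w, Finset.sum_ite, Finset.sum_const,
        Finset.sum_const_zero, add_zero, nsmul_eq_mul, mul_comm]
      congr 2
      rw [← Set.ncard_coe_finset]
      simp
    rw [h2] at h1
    have hc : v y * ((Γ.cell x C y).ncard : ℂ) ≠ 0 := by
      refine mul_ne_zero hy ?_
      exact Nat.cast_ne_zero.2 (Set.ncard_ne_zero_of_mem (mem_cell_self y))
    have h4 : (fun _ => 1 : X → ℂ) ∈ N := by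
      have h5 := hsmul (v y * ((Γ.cell x C y).ncard : ℂ))⁻¹ _ h1
      convert h5 using 1
      ext z
      rw [Pi.smul_apply, smul_eq_mul, inv_mul_cancel₀ hc]
    have h6 : ∀ z, charVec (Γ.cell x C z) ∈ N := by
      intro z
      have h7 := hmul _ (diagonal_cell_mem z) _ h4
      convert h7 using 1
      ext w
      rw [Matrix.mulVec_diagonal, mul_one]
    refine hN.not_ge fun w hw => ?_
    rw [eq_sum_charVec_cell (show w ∈ Γ.cellConstant x C from hw)]
    exact Submodule.sum_mem _ fun z _ => hsmul _ _ (h6 z)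

end SimpleGraph
end

theorem proposition4p4 {F V : Type*} [Field F] [Finite F] [AddCommGroup V] [Module F V]
    [FiniteDimensional F V] (φ : PolarForm F V) (hD : 3 ≤ φ.wittIndex)
    (x : φ.Vertex) (C : Set φ.Vertex) (hC : Maximal φ.dualPolarGraph.IsClique C) (hx : x ∈ C) :
    ∃ W : Submodule (φ.dualPolarGraph.generalizedTerwilliger x C) (φ.Vertex → ℂ),
      (W : Set (φ.Vertex → ℂ)) = φ.dualPolarGraph.primarySubspace φ.wittIndex x C ∧
        IsSimpleModule (φ.dualPolarGraph.generalizedTerwilliger x C) W := by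
  obtain ⟨h, hhx, hd, rfl⟩ := PolarForm.exists_eq_setOf_le (by omega) hC hx
  rw [SimpleGraph.primarySubspace_eq (PolarForm.exists_mem_cell hhx hd)]
  exact SimpleGraph.exists_simple_submodule fun y z hz =>
    PolarForm.exists_equiv hhx hd (Eq.symm hz.1) (Eq.symm hz.2)
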